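/- Let $\mathbb T=\mathbb R/2\pi\mathbb Z$ and let $e^{it\varphi(\partial_x/i)}$, $\varphi(\xi)=-\xi|\xi|$, be the propagator of the linear Benjamin–Ono equation $\partial_t u+\mathcal H\partial_{xx}u=0$ on $L^2(\mathbb T)$, where $\widehat{\mathcal H f}(\xi)=-i\,\mathrm{sgn}(\xi)\hat f(\xi)$. For $N\in\{1,2,4,\dots\}$ let $P_N$ be the projection to the frequencies $k\in\mathbb Z$ with $N\le|k|<2N$ (with $|k|<2$ if $N=1$). For a bounded interval $I=[a,b)$, a $U^2(I)$-atom is a function $\sum_{k=1}^{K}\phi_{k-1}\chi_{[t_{k-1},t_k)}$ with $a=t_0<\dots<t_K=b$, $\phi_k\in L^2(\mathbb T)$ and $\sum_k\|\phi_k\|_{L^2}^2=1$; $\|f\|_{U^2(I)}$ is the infimum of $\sum_n|\lambda_n|$ over all representations $f=\sum_{n}\lambda_n a_n$ on $I$ with $U^2(I)$-atoms $a_n$ (and $\infty$ if there is none); and $\|f\|_{DU^2(I)}=\|w\|_{U^2(I)}$, where $\partial_t w=f$ on $(a,b)$ in the sense of distributions and $\lim_{t\uparrow b}w(t)=0$ (and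 $\infty$ if there is no such $w\in U^2(I)$). Put $\|u\|_{U^2_{BO}(I)}=\|e^{-it\varphi(\partial_x/i)}u\|_{U^2(I)}$ and $\|f\|_{DU^2_{BO}(I)}=\|e^{-it\varphi(\partial_x/i)}f\|_{DU^2(I)}$. For $T\in(0,1]$ and $s\in\mathbb R$ define $$\|u\|_{F^s_{BO}(T)}^2=\sum_{N}N^{2s}\sup_{I}\|P_Nu\|_{U^2_{BO}(I)}^2,\qquad \|f\|_{N^s_{BO}(T)}^2=\sum_{N}N^{2s}\sup_{I}\|P_Nf\|_{DU^2_{BO}(I)}^2,$$ where $N$ runs over $\{1,2,4,\dots\}$ and $I=[a,b)$ runs over the intervals $I\subseteq[0,T]$ of length $\min(N^{-1},T)$. Then for every $s>0$ there is a constant $C=C(s)$ such that for all $T\in(0,1]$ and all $u,v:[0,T]\to L^2(\mathbb T)$ $$\|\partial_x(uv)\|_{N^s_{BO}(T)}\le C\,\|u\|_{F^s_{BO}(T)}\|v\|_{F^s_{BO}(T)},$$ $$\|\partial_x(uv)\|_{N^0_{BO}(T)}\le C\,\|u\|_{F^0_{BO}(T)}\|v\|_{F^s_{BO}(T)}$$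 (norms take values in $[0,\infty]$, and $0\cdot\infty=0$). -/

import Mathlib

open MeasureTheory Filter Topology Set
open scoped ENNReal NNReal

noncomputable section

namespace ShortTimeBO

/-! ### Atomic spaces on a bounded interval `[a, b)`, values in a complex normed space -/

section Atomic

variable {E : Type*} [NormedAddCommGroup E] [NormedSpace ℂ E]

/-- `U²`-atoms on `[a, b)`: step functions `∑ φₖ χ_{[tₖ, tₖ₊₁)}` subordinate to a partition
`a = t₀ < ⋯ < t_K = b`, with `∑ ‖φₖ‖² = 1`. -/
def IsU2Atom (a b : ℝ) (A : ℝ → E) : Prop :=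
  ∃ (K : ℕ) (t : Fin (K + 1) → ℝ) (φ : Fin K → E),
    StrictMono t ∧ t 0 = a ∧ t (Fin.last K) = b ∧ ∑ k, ‖φ k‖ ^ 2 = 1 ∧
    A = fun τ => ∑ k, (Ico (t k.castSucc) (t k.succ)).indicator (fun _ => φ k) τ

/-- The norm of `U²([a, b); E)`; it is `∞` when `f` has no atomic representation on `[a, b)`. -/
def U2norm (a b : ℝ) (f : ℝ → E) : ℝ≥0∞ :=
  ⨅ (c : ℕ → ℂ) (A : ℕ → ℝ → E) (_ : ∀ n, IsU2Atom a b (A n))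
    (_ : ∀ τ ∈ Ico a b, HasSum (fun n => c n • A n τ) (f τ)), ∑' n, ‖c n‖ₑ

/-- `∂ₜ w = f` on `(a, b)` in the sense of vector-valued distributions, for a locally integrable
function `f`. -/
def HasDistribDeriv (a b : ℝ) (w f : ℝ → E) : Prop :=
  LocallyIntegrableOn f (Ioo a b) ∧
  ∀ ψ : ℝ → ℝ, ContDiff ℝ (⊤ : ℕ∞) ψ → HasCompactSupport ψ → tsupport ψ ⊆ Ioo a b →
    ∫ τ in Ioo a b, deriv ψ τ • w τ = - ∫ τ in Ioo a b, ψ τ • f τ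

/-- The norm of `DU²([a, b); E)`: the `U²`-norm of the primitive `w` of `f` whose limit at the
right endpoint vanishes (`w` is unique when it exists); it is `∞` when there is no such `w` in
`U²`. -/
def DU2norm (a b : ℝ) (f : ℝ → E) : ℝ≥0∞ :=
  ⨅ (w : ℝ → E) (_ : Tendsto w (𝓝[<] b) (𝓝 0)) (_ : HasDistribDeriv a b w f), U2norm a b w

end Atomic

/-! ### Fourier analysis on the circle `𝕋 = ℝ / 2πℤ` -/

instance factTwoPiPos : Fact (0 < 2 * Real.pi) := ⟨Real.two_pi_pos⟩

/-- `𝕋 = ℝ / 2πℤ`. -/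
abbrev Circ : Type := AddCircle (2 * Real.pi)

/-- `L²(𝕋; ℂ)`, with respect to the normalized Lebesgue measure. -/
abbrev L2T : Type := Lp ℂ 2 (AddCircle.haarAddCircle (T := 2 * Real.pi))

/-- The Benjamin–Ono dispersion relation: `∂ₜu + 𝓗∂ₓₓu = 0` reads `i∂ₜu + φ(∂ₓ/i)u = 0` with
`φ(ξ) = -ξ|ξ|`. -/
def phase (k : ℤ) : ℝ := -((k : ℝ) * |(k : ℝ)|)

lemma memlp_flow (t : ℝ) (f : L2T) :
    Memℓp (fun k : ℤ => Complex.exp (Complex.I * t * phase k) * fourierBasis.repr f k) 2 := by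
  refine (lp.memℓp (fourierBasis.repr f)).mono' ?_
  intro k
  have h : Complex.I * t * phase k = ((t * phase k : ℝ) : ℂ) * Complex.I := by
    push_cast; ring
  rw [norm_mul, h, Complex.norm_exp_ofReal_mul_I, one_mul]

/-- The linear propagator `e^{itφ(∂ₓ/i)}` on `L²(𝕋)`: the Fourier multiplier `e^{itφ(k)}`. -/
def flow (t : ℝ) (f : L2T) : L2T :=
  fourierBasis.repr.symm
    ⟨fun k => Complex.exp (Complex.I * t * phase k) * fourierBasis.repr f k, memlp_flow t f⟩

/-- The frequencies `k ∈ ℤ` seen by `P_N`, `N = 2 ^ j`: `N ≤ |k| < 2N` if `j ≥ 1`, and `|k| < 2`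
if `j = 0`. -/
def freqs (j : ℕ) : Finset ℤ :=
  (Finset.Ioo (-(2 : ℤ) ^ (j + 1)) ((2 : ℤ) ^ (j + 1))).filter
    (fun k => j = 0 ∨ (2 : ℤ) ^ j ≤ |k|)

/-- `P_N g`, `N = 2 ^ j`, for the periodic distribution `g` with Fourier coefficients
`(c k)`: the trigonometric polynomial `∑_{k ∈ freqs j} c k e^{ikx}`. -/
def dyadicProj (j : ℕ) (c : ℤ → ℂ) : L2T := ∑ k ∈ freqs j, c k • fourierLp 2 k

/-! ### The short-time norms, restricted to `[0, T]` -/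

/-- The length of the time intervals for the frequency `N = 2 ^ j`: `N⁻¹`, or `T` if
`[0, T]` is shorter than that. -/
def window (T : ℝ) (j : ℕ) : ℝ := min (((2 : ℝ) ^ j)⁻¹) T

/-- The norm of `F^s_BO(T)`: with `N = 2 ^ j`, the square root of
`∑_N N^{2s} sup_I ‖e^{-itφ(∂ₓ/i)} P_N u‖²_{U²(I; L²)}`, where `I = [a, a + window T j) ⊆ [0, T]`. -/
def FBO (s T : ℝ) (u : ℝ → L2T) : ℝ≥0∞ :=
  (∑' j : ℕ, ((2 : ℝ≥0∞) ^ j) ^ (2 * s) *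
    (⨆ (a : ℝ) (_ : 0 ≤ a) (_ : a + window T j ≤ T),
      U2norm a (a + window T j)
        (fun t => flow (-t) (dyadicProj j (fourierCoeff (u t))))) ^ 2) ^ (1 / 2 : ℝ)

/-- The norm of `N^s_BO(T)`, for a time-dependent periodic distribution `g` given by its
(spatial) Fourier coefficients `g t k`: as `FBO`, with `DU²` in place of `U²`. -/
def NBO (s T : ℝ) (g : ℝ → ℤ → ℂ) : ℝ≥0∞ :=
  (∑' j : ℕ, ((2 : ℝ≥0∞) ^ j) ^ (2 * s) *
    (⨆ (a : ℝ) (_ : 0 ≤ a) (_ : a + window T j ≤ T),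
      DU2norm a (a + window T j)
        (fun t => flow (-t) (dyadicProj j (g t)))) ^ 2) ^ (1 / 2 : ℝ)

/-- The Fourier coefficients of the distribution `∂ₓ(u(t) v(t))`; the product of two
`L²`-functions is in `L¹(𝕋)`. -/
def dxMul (u v : ℝ → L2T) (t : ℝ) (k : ℤ) : ℂ :=
  Complex.I * k * fourierCoeff (fun x : Circ => u t x * v t x) k

end ShortTimeBO

end

/-!
In terms of the profiles `e^{-itφ(∂ₓ/i)}u` and `e^{-itφ(∂ₓ/i)}v`, the form `∂ₓ(uv)` has the Fourier
symbol `ik e^{-itω}`, where the resonance `ω = φ(k) - φ(p) - φ(k - p)` is at least the product of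
the smallest and the largest of the frequencies `|k|`, `|p|`, `|k - p|`. Interpolating between the
two bounds `|J|` and `2 / |ω|` for `∫_J e^{-itω}` and using Cauchy–Schwarz for the convolution in
the frequency, whose cost is the square root of the smallest frequency, one finds that the integral
over `J` of the interaction of two time-independent profiles is `O(|J|^{1/2})`, with a constant that
no longer sees the smallest frequency. By Cauchy–Schwarz over the steps of two atoms this bound
passes to profiles in `U²`.

On the other side, the `DU²`-norm of `f` is at most `∑ₙ 2^{n/2} sup_J ‖∫_J f‖` with the supremum
over the dyadic subintervals `J` of level `n`: this is the telescoping series of the step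
approximations of the primitive. The terms of this series grow or decay geometrically except in a
range of `n` whose length is the logarithm of the smallest frequency. The factor `N^s`, `s > 0`, in
the norm of one of the inputs absorbs this loss, and what is left is a geometrically decaying kernel
in the dyadic frequencies, to which Schur's test applies.
-/

namespace ShortTimeBO

noncomputable section

/-! ### Step functions and atoms -/

section StepFunctions

variable {F : Type*} {K : ℕ} {t : Fin (K + 1) → ℝ}

/-- The `k`-th interval of the partition with endpoints `t`. -/
def cell (t : Fin (K + 1) → ℝ) (k : Fin K) : Set ℝ := Ico (t k.castSucc) (t k.succ)

/-- The step function with value `φ k` on the `k`-th cell of the partition `t`, and `0` off the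
cells; atoms are step functions by definition. -/
def stepFun [AddCommMonoid F] (t : Fin (K + 1) → ℝ) (φ : Fin K → F) (τ : ℝ) : F :=
  ∑ k, (cell t k).indicator (fun _ => φ k) τ

lemma measurableSet_cell (k : Fin K) : MeasurableSet (cell t k) := measurableSet_Ico

lemma pairwise_disjoint_cell (ht : Monotone t) : Pairwise (Function.onFun Disjoint (cell t)) :=
  (pairwise_disjoint_on _).2 fun _ _ hkl => Ico_disjoint_Ico.2 <|
    (min_le_left _ _).trans ((ht (Fin.succ_le_castSucc_iff.2 hkl)).trans (le_max_right _ _))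

lemma stepFun_eq_of_mem_cell [AddCommMonoid F] (ht : Monotone t) (φ : Fin K → F) {k : Fin K}
    {τ : ℝ} (hk : τ ∈ cell t k) : stepFun t φ τ = φ k := by
  rw [stepFun, Finset.sum_eq_single k, indicator_of_mem hk]
  · exact fun l _ hl => indicator_of_notMem
      (fun h => disjoint_left.1 (pairwise_disjoint_cell ht hl) h hk) _
  · exact fun h => absurd (Finset.mem_univ k) h

lemma stepFun_eq_zero_of_forall_notMem_cell [AddCommMonoid F] (φ : Fin K → F) {τ : ℝ}
    (h : ∀ k, τ ∉ cell t k) : stepFun t φ τ = 0 :=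
  Finset.sum_eq_zero fun k _ => indicator_of_notMem (h k) _

lemma stepFun_smul [AddCommMonoid F] [DistribSMul ℂ F] (z : ℂ) (φ : Fin K → F) (τ : ℝ) :
    stepFun t (z • φ) τ = z • stepFun t φ τ := by
  simp only [stepFun, Finset.smul_sum, ← indicator_const_smul_apply, Pi.smul_apply]

lemma norm_stepFun_le [NormedAddCommGroup F] (ht : Monotone t) (φ : Fin K → F) (τ : ℝ) :
    ‖stepFun t φ τ‖ ≤ √(∑ k, ‖φ k‖ ^ 2) := by
  by_cases h : ∃ k, τ ∈ cell t k
  · obtain ⟨k, hk⟩ := h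
    rw [stepFun_eq_of_mem_cell ht φ hk]
    exact Real.le_sqrt_of_sq_le
      (Finset.single_le_sum (fun i _ => sq_nonneg ‖φ i‖) (Finset.mem_univ k))
  · rw [stepFun_eq_zero_of_forall_notMem_cell φ (not_exists.1 h), norm_zero]
    exact Real.sqrt_nonneg _

lemma stronglyMeasurable_stepFun [NormedAddCommGroup F] (t : Fin (K + 1) → ℝ) (φ : Fin K → F) :
    StronglyMeasurable (stepFun t φ) :=
  Finset.stronglyMeasurable_fun_sum _ fun k _ =>
    stronglyMeasurable_const.indicator (measurableSet_cell k)

end StepFunctions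

section Atoms

variable {E : Type*} [NormedAddCommGroup E] {a b : ℝ} {A : ℝ → E}

lemma IsU2Atom.enorm_le (hA : IsU2Atom a b A) (τ : ℝ) : ‖A τ‖ₑ ≤ 1 := by
  obtain ⟨K, t, φ, ht, -, -, hφ, rfl⟩ := hA
  rw [← ofReal_norm, ENNReal.ofReal_le_one]
  exact (norm_stepFun_le ht.monotone φ τ).trans_eq (by rw [hφ, Real.sqrt_one])

lemma IsU2Atom.stronglyMeasurable (hA : IsU2Atom a b A) : StronglyMeasurable A := by
  obtain ⟨K, t, φ, -, -, -, -, rfl⟩ := hA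
  exact stronglyMeasurable_stepFun t φ

variable [NormedSpace ℂ E]

lemma exists_isU2Atom [Nontrivial E] (hab : a < b) : ∃ A : ℝ → E, IsU2Atom a b A := by
  obtain ⟨x, hx⟩ := exists_norm_eq E zero_le_one
  refine ⟨_, 1, ![a, b], ![x], ?_, rfl, rfl, by simp [hx], rfl⟩
  exact Fin.strictMono_iff_lt_succ.2 fun i => by fin_cases i; exact hab

lemma exists_isU2Atom_smul_eq_stepFun [Nontrivial E] (hab : a < b) {K : ℕ}
    {t : Fin (K + 1) → ℝ} (ht : StrictMono t) (h0 : t 0 = a) (hK : t (Fin.last K) = b)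
    (φ : Fin K → E) :
    ∃ A : ℝ → E, IsU2Atom a b A ∧ ∀ τ, ((√(∑ k, ‖φ k‖ ^ 2) : ℝ) : ℂ) • A τ = stepFun t φ τ := by
  set r := √(∑ k, ‖φ k‖ ^ 2) with hr
  rcases (Real.sqrt_nonneg (∑ k, ‖φ k‖ ^ 2)).eq_or_lt with h | h
  · obtain ⟨A, hA⟩ := exists_isU2Atom (E := E) hab
    refine ⟨A, hA, fun τ => ?_⟩
    have hle := norm_stepFun_le ht.monotone φ τ
    rw [← h] at hle
    rw [hr, ← h, norm_le_zero_iff.1 hle, Complex.ofReal_zero, zero_smul]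
  · refine ⟨stepFun t ((r : ℂ)⁻¹ • φ), ⟨K, t, _, ht, h0, hK, ?_, rfl⟩, fun τ => ?_⟩
    · have hterm (k : Fin K) : ‖((r : ℂ)⁻¹ • φ) k‖ ^ 2 = (r ^ 2)⁻¹ * ‖φ k‖ ^ 2 := by
        rw [Pi.smul_apply, norm_smul, norm_inv, Complex.norm_real,
          Real.norm_of_nonneg h.le, mul_pow, inv_pow]
      have hsq : r ^ 2 = ∑ k, ‖φ k‖ ^ 2 :=
        Real.sq_sqrt (Finset.sum_nonneg fun k _ => sq_nonneg ‖φ k‖)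
      rw [Finset.sum_congr rfl fun k _ => hterm k, ← Finset.mul_sum, ← hsq,
        inv_mul_cancel₀ (pow_pos h 2).ne']
    · rw [stepFun_smul, smul_inv_smul₀ (Complex.ofReal_ne_zero.2 h.ne')]

end Atoms

/-! ### The space `U²` -/

section U2

variable {E G : Type*} [NormedAddCommGroup E] [NormedSpace ℂ E]
  [NormedAddCommGroup G] [NormedSpace ℂ G] {a b : ℝ} {f : ℝ → E}

lemma exists_atomic_representation_of_U2norm_lt {r : ℝ≥0∞} (h : U2norm a b f < r) :
    ∃ (c : ℕ → ℂ) (A : ℕ → ℝ → E), (∀ n, IsU2Atom a b (A n)) ∧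
      (∀ τ ∈ Ico a b, HasSum (fun n => c n • A n τ) (f τ)) ∧ ∑' n, ‖c n‖ₑ < r := by
  simpa only [U2norm, iInf_lt_iff, exists_prop] using h

lemma U2norm_le_tsum_enorm {c : ℕ → ℂ} {A : ℕ → ℝ → E} (hA : ∀ n, IsU2Atom a b (A n))
    (hf : ∀ τ ∈ Ico a b, HasSum (fun n => c n • A n τ) (f τ)) :
    U2norm a b f ≤ ∑' n, ‖c n‖ₑ :=
  iInf_le_of_le c <| iInf_le_of_le A <| iInf_le_of_le hA <| iInf_le_of_le hf le_rfl

lemma U2norm_le_tsum_of_hasSum_stepFun [Nontrivial E] (hab : a < b) {K : ℕ → ℕ}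
    {t : ∀ n, Fin (K n + 1) → ℝ} {φ : ∀ n, Fin (K n) → E} (ht : ∀ n, StrictMono (t n))
    (h0 : ∀ n, t n 0 = a) (hK : ∀ n, t n (Fin.last _) = b)
    (hf : ∀ τ ∈ Ico a b, HasSum (fun n => stepFun (t n) (φ n) τ) (f τ)) :
    U2norm a b f ≤ ∑' n, ENNReal.ofReal √(∑ k, ‖φ n k‖ ^ 2) := by
  choose A hA hAφ using fun n => exists_isU2Atom_smul_eq_stepFun hab (ht n) (h0 n) (hK n) (φ n)
  refine (U2norm_le_tsum_enorm hA (c := fun n => ((√(∑ k, ‖φ n k‖ ^ 2) : ℝ) : ℂ))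
    fun τ hτ => ?_).trans_eq (tsum_congr fun n => ?_)
  · simpa only [hAφ] using hf τ hτ
  · rw [← ofReal_norm, Complex.norm_real, Real.norm_of_nonneg (Real.sqrt_nonneg _)]

lemma enorm_le_U2norm (f : ℝ → E) {τ : ℝ} (hτ : τ ∈ Ico a b) : ‖f τ‖ₑ ≤ U2norm a b f :=
  le_iInf fun c => le_iInf fun _ => le_iInf fun hA => le_iInf fun hf =>
    (hf τ hτ).enorm_le_of_bounded (ENNReal.summable (f := fun n => ‖c n‖ₑ)).hasSum fun n => by
      rw [enorm_smul]
      exact mul_le_of_le_one_right' ((hA n).enorm_le τ)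

lemma aestronglyMeasurable_of_U2norm_ne_top (h : U2norm a b f ≠ ∞) :
    AEStronglyMeasurable f (volume.restrict (Ico a b)) := by
  obtain ⟨c, A, hA, hf, -⟩ := exists_atomic_representation_of_U2norm_lt h.lt_top
  refine aestronglyMeasurable_of_tendsto_ae
    (f := fun (m : ℕ) τ => ∑ n ∈ Finset.range m, c n • A n τ) atTop (fun m => ?_) ?_
  · exact (Finset.stronglyMeasurable_fun_sum _ fun n _ =>
      (hA n).stronglyMeasurable.const_smul (c n)).aestronglyMeasurable
  · filter_upwards [ae_restrict_mem measurableSet_Ico] with τ hτ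
    exact (hf τ hτ).tendsto_sum_nat

lemma hasSum_integral_clm_apply {μ : Measure ℝ} [IsFiniteMeasure μ]
    (hμ : ∀ᵐ τ ∂μ, τ ∈ Ico a b) {Λ : ℝ → E →L[ℂ] G}
    (hΛ : ∀ A : ℝ → E, StronglyMeasurable A → AEStronglyMeasurable (fun τ => Λ τ (A τ)) μ)
    {D : ℝ} (hD : ∀ᵐ τ ∂μ, ‖Λ τ‖ ≤ D) {c : ℕ → ℂ} {A : ℕ → ℝ → E}
    (hA : ∀ n, IsU2Atom a b (A n)) (hc : Summable fun n => ‖c n‖)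
    (hf : ∀ τ ∈ Ico a b, HasSum (fun n => c n • A n τ) (f τ)) :
    HasSum (fun n => c n • ∫ τ, Λ τ (A n τ) ∂μ) (∫ τ, Λ τ (f τ) ∂μ) := by
  have hnorm (n : ℕ) (τ : ℝ) : ‖A n τ‖ ≤ 1 := by
    simpa only [← ofReal_norm, ENNReal.ofReal_le_one] using (hA n).enorm_le τ
  simp_rw [← integral_smul, ← map_smul]
  refine hasSum_integral_of_dominated_convergence (fun n _ => D * ‖c n‖)
    (fun n => hΛ _ ((hA n).stronglyMeasurable.const_smul (c n))) (fun n => ?_)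
    (Eventually.of_forall fun _ => hc.mul_left D) (integrable_const _) ?_
  · filter_upwards [hD] with τ hτ
    refine (Λ τ).le_of_opNorm_le_of_le hτ ?_
    rw [norm_smul]
    exact mul_le_of_le_one_right (norm_nonneg _) (hnorm n τ)
  · filter_upwards [hμ] with τ hτ using (hf τ hτ).mapL (Λ τ)

lemma enorm_integral_clm_apply_le_mul_U2norm {μ : Measure ℝ} [IsFiniteMeasure μ]
    (hμ : ∀ᵐ τ ∂μ, τ ∈ Ico a b) {Λ : ℝ → E →L[ℂ] G}
    (hΛ : ∀ A : ℝ → E, StronglyMeasurable A → AEStronglyMeasurable (fun τ => Λ τ (A τ)) μ)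
    {D : ℝ} (hD : ∀ᵐ τ ∂μ, ‖Λ τ‖ ≤ D) {M : ℝ≥0∞} (hM : M ≠ ∞)
    (hatom : ∀ A : ℝ → E, IsU2Atom a b A → ‖∫ τ, Λ τ (A τ) ∂μ‖ₑ ≤ M) (hf : U2norm a b f ≠ ∞) :
    ‖∫ τ, Λ τ (f τ) ∂μ‖ₑ ≤ M * U2norm a b f := by
  refine ENNReal.le_mul_of_forall_lt (.inr hf) (.inl hM) fun M' hM' r hr => ?_
  obtain ⟨c, A, hA, hfA, hc⟩ := exists_atomic_representation_of_U2norm_lt hr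
  have hsum := hasSum_integral_clm_apply hμ hΛ hD hA
    (tsum_enorm_ne_top_iff_summable_norm.1 hc.ne_top) hfA
  calc ‖∫ τ, Λ τ (f τ) ∂μ‖ₑ ≤ ∑' n, M * ‖c n‖ₑ :=
        hsum.enorm_le_of_bounded ENNReal.summable.hasSum fun n => by
          rw [enorm_smul, mul_comm M]
          gcongr
          exact hatom (A n) (hA n)
    _ = M * ∑' n, ‖c n‖ₑ := ENNReal.tsum_mul_left
    _ ≤ M' * r := mul_le_mul' hM'.le hc.le

end U2

/-! ### Bilinear forms with square-root decay of their time integrals -/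

section Bilinear

variable {E E' G : Type*} [NormedAddCommGroup E] [NormedSpace ℂ E]
  [NormedAddCommGroup E'] [NormedSpace ℂ E'] [NormedAddCommGroup G] [NormedSpace ℂ G]
  {B : ℝ → E →L[ℂ] E' →L[ℂ] G} {a b a' b' c d : ℝ}

lemma aestronglyMeasurable_bilinear_apply (hB : Continuous B) {μ : Measure ℝ} {x : ℝ → E}
    {y : ℝ → E'} (hx : AEStronglyMeasurable x μ) (hy : AEStronglyMeasurable y μ) :
    AEStronglyMeasurable (fun τ => B τ (x τ) (y τ)) μ := by
  have hcont : Continuous fun p : ℝ × E × E' => B p.1 p.2.1 p.2.2 := by fun_prop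
  exact hcont.comp_aestronglyMeasurable (aestronglyMeasurable_id.prodMk (hx.prodMk hy))

lemma bilinear_stepFun_apply (B : E →L[ℂ] E' →L[ℂ] G) {K K' : ℕ} (t : Fin (K + 1) → ℝ)
    (t' : Fin (K' + 1) → ℝ) (φ : Fin K → E) (φ' : Fin K' → E') (τ : ℝ) :
    B (stepFun t φ τ) (stepFun t' φ' τ) =
      ∑ p : Fin K × Fin K',
        (cell t p.1 ∩ cell t' p.2).indicator (fun _ => B (φ p.1) (φ' p.2)) τ := by
  rw [stepFun, stepFun, map_sum B, sum_apply, Fintype.sum_prod_type]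
  refine Finset.sum_congr rfl fun k _ => ?_
  rw [map_sum]
  refine Finset.sum_congr rfl fun l _ => ?_
  by_cases hk : τ ∈ cell t k <;> by_cases hl : τ ∈ cell t' l <;> simp [hk, hl]

lemma sum_measureReal_cell_inter_cell_le {K K' : ℕ} {t : Fin (K + 1) → ℝ} {t' : Fin (K' + 1) → ℝ}
    (ht : Monotone t) (ht' : Monotone t') (μ : Measure ℝ) [IsFiniteMeasure μ] :
    ∑ p : Fin K × Fin K', μ.real (cell t p.1 ∩ cell t' p.2) ≤ μ.real univ := by
  refine sum_measureReal_le_measureReal_univ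
    (fun p _ => (measurableSet_cell p.1).inter (measurableSet_cell p.2)) fun p _ q _ hpq => ?_
  by_cases h : p.1 = q.1
  · exact (pairwise_disjoint_cell ht' fun h' => hpq (Prod.ext h h')).mono
      inter_subset_right inter_subset_right
  · exact (pairwise_disjoint_cell ht h).mono inter_subset_left inter_subset_left

lemma norm_setIntegral_cell_inter_cell_le {f : ℝ → G} {M : ℝ}
    (hf : ∀ c d, c ≤ d → ‖∫ τ in Ico c d, f τ‖ ≤ M * √(d - c)) {K K' : ℕ}
    (t : Fin (K + 1) → ℝ) (t' : Fin (K' + 1) → ℝ) (c d : ℝ) (p : Fin K × Fin K') :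
    ‖∫ τ in Ico c d, (cell t p.1 ∩ cell t' p.2).indicator f τ‖ ≤
      M * √((volume.restrict (Ico c d)).real (cell t p.1 ∩ cell t' p.2)) := by
  have hmeas := (measurableSet_cell (t := t) p.1).inter (measurableSet_cell (t := t') p.2)
  rw [setIntegral_indicator hmeas, measureReal_restrict_apply hmeas, inter_comm _ (Ico c d)]
  simp only [cell, Ico_inter_Ico]
  set c' := max c (max (t p.1.castSucc) (t' p.2.castSucc))
  set d' := min d (min (t p.1.succ) (t' p.2.succ))
  rcases le_total c' d' with h | h
  · rw [Real.volume_real_Ico_of_le h]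
    exact hf _ _ h
  · simp [Ico_eq_empty h.not_gt]

/-- Cauchy–Schwarz over the pairs of cells: the lengths of the pairwise intersections of the cells
sum to at most `d - c`, so the square root of the length survives the summation. -/
lemma norm_integral_bilinear_stepFun_le (hB : Continuous B) {L : ℝ} (hL0 : 0 ≤ L)
    (hL : ∀ (x : E) (y : E') (c d : ℝ), c ≤ d →
      ‖∫ τ in Ico c d, B τ x y‖ ≤ L * √(d - c) * ‖x‖ * ‖y‖)
    (hcd : c ≤ d) {K K' : ℕ} {t : Fin (K + 1) → ℝ} {t' : Fin (K' + 1) → ℝ}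
    (ht : Monotone t) (ht' : Monotone t') (φ : Fin K → E) (φ' : Fin K' → E') :
    ‖∫ τ in Ico c d, B τ (stepFun t φ τ) (stepFun t' φ' τ)‖ ≤
      L * √(d - c) * (√(∑ k, ‖φ k‖ ^ 2) * √(∑ k, ‖φ' k‖ ^ 2)) := by
  set μ := volume.restrict (Ico c d) with hμ
  set ℓ : Fin K × Fin K' → ℝ := fun p => μ.real (cell t p.1 ∩ cell t' p.2)
  have hℓ : ∑ p, ℓ p ≤ d - c :=
    (sum_measureReal_cell_inter_cell_le ht ht' μ).trans_eq (by simp [hμ, hcd])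
  have hint (p : Fin K × Fin K') :
      Integrable ((cell t p.1 ∩ cell t' p.2).indicator fun τ => B τ (φ p.1) (φ' p.2)) μ := by
    refine Integrable.indicator ?_ ((measurableSet_cell p.1).inter (measurableSet_cell p.2))
    exact (Continuous.integrableOn_Icc (by fun_prop)).mono_set Ico_subset_Icc_self
  have hcell (p : Fin K × Fin K') := norm_setIntegral_cell_inter_cell_le
    (f := fun τ => B τ (φ p.1) (φ' p.2)) (M := L * (‖φ p.1‖ * ‖φ' p.2‖))
    (fun c d hcd => (hL _ _ c d hcd).trans_eq (by ring)) t t' c d p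
  have hsq : ∑ p : Fin K × Fin K', (‖φ p.1‖ * ‖φ' p.2‖) ^ 2 =
      (∑ k, ‖φ k‖ ^ 2) * ∑ k, ‖φ' k‖ ^ 2 := by
    simp only [mul_pow, Fintype.sum_mul_sum, Fintype.sum_prod_type]
  calc ‖∫ τ, B τ (stepFun t φ τ) (stepFun t' φ' τ) ∂μ‖
      = ‖∑ p : Fin K × Fin K', ∫ τ, (cell t p.1 ∩ cell t' p.2).indicator
          (fun τ => B τ (φ p.1) (φ' p.2)) τ ∂μ‖ := by
        rw [← integral_finsetSum _ fun p _ => hint p]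
        simp only [bilinear_stepFun_apply, indicator]
    _ ≤ ∑ p : Fin K × Fin K', L * (‖φ p.1‖ * ‖φ' p.2‖) * √(ℓ p) :=
        (norm_sum_le _ _).trans (Finset.sum_le_sum fun p _ => hcell p)
    _ = L * ∑ p : Fin K × Fin K', √(ℓ p) * (‖φ p.1‖ * ‖φ' p.2‖) := by
        rw [Finset.mul_sum]
        exact Finset.sum_congr rfl fun p _ => by ring
    _ ≤ L * (√(∑ p, √(ℓ p) ^ 2) * √(∑ p : Fin K × Fin K', (‖φ p.1‖ * ‖φ' p.2‖) ^ 2)) := by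
        gcongr
        exact Real.sum_mul_le_sqrt_mul_sqrt _ _ _
    _ ≤ L * √(d - c) * (√(∑ k, ‖φ k‖ ^ 2) * √(∑ k, ‖φ' k‖ ^ 2)) := by
        rw [hsq, Real.sqrt_mul (Finset.sum_nonneg fun k _ => sq_nonneg ‖φ k‖),
          Finset.sum_congr rfl fun p _ => Real.sq_sqrt measureReal_nonneg, mul_assoc L]
        gcongr

lemma enorm_integral_bilinear_atoms_le (hB : Continuous B) {L : ℝ} (hL0 : 0 ≤ L)
    (hL : ∀ (x : E) (y : E') (c d : ℝ), c ≤ d →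
      ‖∫ τ in Ico c d, B τ x y‖ ≤ L * √(d - c) * ‖x‖ * ‖y‖)
    (hcd : c ≤ d) {A : ℝ → E} {A' : ℝ → E'} (hA : IsU2Atom a b A) (hA' : IsU2Atom a' b' A') :
    ‖∫ τ in Ico c d, B τ (A τ) (A' τ)‖ₑ ≤ ENNReal.ofReal (L * √(d - c)) := by
  obtain ⟨K, t, φ, ht, -, -, hφ, rfl⟩ := hA
  obtain ⟨K', t', φ', ht', -, -, hφ', rfl⟩ := hA'
  have h := norm_integral_bilinear_stepFun_le hB hL0 hL hcd ht.monotone ht'.monotone φ φ'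
  rw [hφ, hφ', Real.sqrt_one, mul_one, mul_one] at h
  rw [← ofReal_norm]
  exact ENNReal.ofReal_le_ofReal h

lemma enorm_integral_bilinear_le_mul_U2norm (hB : Continuous B) {L : ℝ} (hL0 : 0 ≤ L)
    (hL : ∀ (x : E) (y : E') (c d : ℝ), c ≤ d →
      ‖∫ τ in Ico c d, B τ x y‖ ≤ L * √(d - c) * ‖x‖ * ‖y‖)
    (hcd : c ≤ d) (h : Ico c d ⊆ Ico a b) (h' : Ico c d ⊆ Ico a' b')
    {x : ℝ → E} {y : ℝ → E'} (hx : U2norm a b x ≠ ∞) (hy : U2norm a' b' y ≠ ∞) :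
    ‖∫ τ in Ico c d, B τ (x τ) (y τ)‖ₑ ≤
      ENNReal.ofReal (L * √(d - c)) * U2norm a b x * U2norm a' b' y := by
  obtain ⟨D, hD⟩ := isCompact_Icc.exists_bound_of_continuousOn (f := B)
    (hB.continuousOn (s := Icc c d))
  have hmem : ∀ᵐ τ ∂volume.restrict (Ico c d), τ ∈ Ico c d := ae_restrict_mem measurableSet_Ico
  have hxm : AEStronglyMeasurable x (volume.restrict (Ico c d)) :=
    (aestronglyMeasurable_of_U2norm_ne_top hx).mono_set h
  refine enorm_integral_clm_apply_le_mul_U2norm (Λ := fun τ => B τ (x τ))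
    (D := D * (U2norm a b x).toReal) (hmem.mono fun τ hτ => h' hτ)
    (fun A' hA' => aestronglyMeasurable_bilinear_apply hB hxm hA'.aestronglyMeasurable) ?_
    (ENNReal.mul_ne_top ENNReal.ofReal_ne_top hx) (fun A' hA' => ?_) hy
  · filter_upwards [hmem] with τ hτ
    refine (B τ).le_of_opNorm_le_of_le (hD τ (Ico_subset_Icc_self hτ)) ?_
    simpa using ENNReal.toReal_mono hx (enorm_le_U2norm x (h hτ))
  · refine enorm_integral_clm_apply_le_mul_U2norm (Λ := fun τ => (B τ).flip (A' τ)) (D := D * 1)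
      (hmem.mono fun τ hτ => h hτ) (fun A hA => aestronglyMeasurable_bilinear_apply hB
        hA.aestronglyMeasurable hA'.stronglyMeasurable.aestronglyMeasurable) ?_
      ENNReal.ofReal_ne_top
      (fun A hA => enorm_integral_bilinear_atoms_le hB hL0 hL hcd hA hA') hx
    filter_upwards [hmem] with τ hτ
    refine (B τ).flip.le_of_opNorm_le_of_le ?_ ?_
    · rw [ContinuousLinearMap.opNorm_flip]
      exact hD τ (Ico_subset_Icc_self hτ)
    · simpa only [← ofReal_norm, ENNReal.ofReal_le_one] using hA'.enorm_le τ

end Bilinear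

/-! ### Dyadic grids -/

section Grid

variable {a b τ : ℝ}

/-- The `i`-th point of the grid of mesh `2⁻ⁿ (b - a)` in `[a, b]`, meant for `i ≤ 2 ^ n`. -/
def grid (a b : ℝ) (n i : ℕ) : ℝ := a + i * ((b - a) / 2 ^ n)

/-- The index of the cell of the grid of level `n` that contains `τ`, for `τ ∈ [a, b)`. -/
def gridIndex (a b : ℝ) (n : ℕ) (τ : ℝ) : ℕ := ⌊(τ - a) / (b - a) * 2 ^ n⌋₊

/-- The `i`-th cell `[grid a b n i, grid a b n (i + 1))` of the grid of level `n`. -/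
def gridCell (a b : ℝ) (n i : ℕ) : Set ℝ := Ico (grid a b n i) (grid a b n (i + 1))

lemma grid_zero (a b : ℝ) (n : ℕ) : grid a b n 0 = a := by simp [grid]

lemma grid_two_pow (a b : ℝ) (n : ℕ) : grid a b n (2 ^ n) = b := by
  simp only [grid]; push_cast; field_simp; ring

lemma grid_succ_two_mul (a b : ℝ) (n i : ℕ) : grid a b (n + 1) (2 * i) = grid a b n i := by
  simp only [grid]; push_cast; rw [pow_succ]; field_simp

lemma grid_succ_sub_grid (a b : ℝ) (n i : ℕ) :
    grid a b n (i + 1) - grid a b n i = (b - a) / 2 ^ n := by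
  simp only [grid]; push_cast; ring

lemma strictMono_grid (hab : a < b) (n : ℕ) : StrictMono (grid a b n) :=
  strictMono_nat_of_lt_succ fun i => sub_pos.1 <| by
    rw [grid_succ_sub_grid]
    exact div_pos (sub_pos.2 hab) (by positivity)

lemma grid_mem_Icc (hab : a < b) {n i : ℕ} (hi : i ≤ 2 ^ n) : grid a b n i ∈ Icc a b :=
  ⟨(grid_zero a b n).ge.trans ((strictMono_grid hab n).monotone (Nat.zero_le i)),
    ((strictMono_grid hab n).monotone hi).trans (grid_two_pow a b n).le⟩

lemma gridIndex_succ_div_two (a b : ℝ) (n : ℕ) (τ : ℝ) :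
    gridIndex a b (n + 1) τ / 2 = gridIndex a b n τ := by
  rw [gridIndex, gridIndex, ← Nat.floor_div_ofNat, pow_succ, ← mul_assoc,
    mul_div_cancel_right₀ _ two_ne_zero]

lemma gridIndex_lt (n : ℕ) (hτ : τ ∈ Ico a b) : gridIndex a b n τ < 2 ^ n := by
  have hab : 0 < b - a := sub_pos.2 (hτ.1.trans_lt hτ.2)
  rw [gridIndex, Nat.floor_lt
    (mul_nonneg (div_nonneg (sub_nonneg.2 hτ.1) hab.le) (by positivity))]
  push_cast
  exact mul_lt_of_lt_one_left (by positivity) ((div_lt_one hab).2 (by linarith [hτ.2]))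

lemma mem_gridCell_gridIndex (n : ℕ) (hτ : τ ∈ Ico a b) :
    τ ∈ gridCell a b n (gridIndex a b n τ) := by
  have hab : 0 < b - a := sub_pos.2 (hτ.1.trans_lt hτ.2)
  have hmesh : 0 < (b - a) / 2 ^ n := div_pos hab (by positivity)
  have hpos : 0 ≤ (τ - a) / (b - a) * 2 ^ n :=
    mul_nonneg (div_nonneg (sub_nonneg.2 hτ.1) hab.le) (by positivity)
  have hτ_eq : (τ - a) / (b - a) * 2 ^ n * ((b - a) / 2 ^ n) = τ - a := by field_simp
  have hlower := mul_le_mul_of_nonneg_right (Nat.floor_le hpos) hmesh.le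
  have hupper := mul_lt_mul_of_pos_right
    (Nat.lt_floor_add_one ((τ - a) / (b - a) * 2 ^ n)) hmesh
  rw [hτ_eq] at hlower hupper
  simp only [gridCell, grid, gridIndex, mem_Ico]
  push_cast
  exact ⟨by linarith, by linarith⟩

lemma tendsto_grid_gridIndex_add_one (hτ : τ ∈ Ico a b) :
    Tendsto (fun n => grid a b n (gridIndex a b n τ + 1)) atTop (𝓝 τ) := by
  have hmesh : Tendsto (fun n : ℕ => (b - a) / 2 ^ n) atTop (𝓝 0) :=
    tendsto_const_nhds.div_atTop (tendsto_pow_atTop_atTop_of_one_lt one_lt_two)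
  refine tendsto_of_tendsto_of_tendsto_of_le_of_le tendsto_const_nhds
    (by simpa only [add_zero] using hmesh.const_add τ)
    (fun n => (mem_gridCell_gridIndex n hτ).2.le) fun n => ?_
  have hleft := (mem_gridCell_gridIndex n hτ).1
  have hstep := grid_succ_sub_grid a b n (gridIndex a b n τ)
  simp only
  linarith

lemma gridCell_subset (hab : a < b) {n i : ℕ} (hi : i < 2 ^ n) : gridCell a b n i ⊆ Ico a b :=
  Ico_subset_Ico (grid_mem_Icc hab hi.le).1 (grid_mem_Icc hab hi).2

variable {E : Type*} [NormedAddCommGroup E] [NormedSpace ℝ E] {f : ℝ → E}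

lemma setIntegral_gridCell_eq_add (hab : a < b) (hf : IntegrableOn f (Ico a b)) {n i : ℕ}
    (hi : i < 2 ^ n) :
    ∫ τ in gridCell a b n i, f τ =
      (∫ τ in gridCell a b (n + 1) (2 * i), f τ) +
        ∫ τ in gridCell a b (n + 1) (2 * i + 1), f τ := by
  have hmono := (strictMono_grid hab (n + 1)).monotone
  have hint (l : ℕ) (hl : l < 2 ^ (n + 1)) : IntegrableOn f (gridCell a b (n + 1) l) :=
    hf.mono_set (gridCell_subset hab hl)
  have hunion : gridCell a b n i = gridCell a b (n + 1) (2 * i) ∪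
      gridCell a b (n + 1) (2 * i + 1) := by
    rw [gridCell, gridCell, gridCell, Ico_union_Ico_eq_Ico (hmono (Nat.le_succ _))
      (hmono (Nat.le_succ _)), grid_succ_two_mul, ← grid_succ_two_mul a b n (i + 1), mul_add]
  have := pow_succ 2 n
  have hdisj : Disjoint (gridCell a b (n + 1) (2 * i)) (gridCell a b (n + 1) (2 * i + 1)) :=
    Ico_disjoint_Ico_same
  rw [hunion, setIntegral_union hdisj measurableSet_Ico (hint _ (by lia)) (hint _ (by lia))]

lemma enorm_setIntegral_gridCell_le_two_pow_mul (hab : a < b) (hf : IntegrableOn f (Ico a b))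
    {n r : ℕ} {β : ℝ≥0∞} (hβ : ∀ i < 2 ^ (n + r), ‖∫ τ in gridCell a b (n + r) i, f τ‖ₑ ≤ β)
    {i : ℕ} (hi : i < 2 ^ n) :
    ‖∫ τ in gridCell a b n i, f τ‖ₑ ≤ 2 ^ r * β := by
  induction r generalizing β with
  | zero => simpa using hβ i hi
  | succ r ih =>
    simp only [← add_assoc, pow_succ _ (n + r)] at hβ
    rw [pow_succ, mul_assoc]
    refine ih fun l hl => ?_
    rw [setIntegral_gridCell_eq_add hab hf hl, two_mul β]
    exact (enorm_add_le _ _).trans (add_le_add (hβ _ (by lia)) (hβ _ (by lia)))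

end Grid

/-! ### Chaining -/

section Chaining

variable {E : Type*} [NormedAddCommGroup E] {a b τ : ℝ} {w : ℝ → E}

/-- The values on the cells of the grid of level `n + 1` of the difference between the
approximations of `w` at levels `n + 1` and `n`; the approximation at level `n` takes on each cell
the value of `w` at the right endpoint of the cell, so that it equals `w b` at level `0`. -/
def dyadicIncrement (a b : ℝ) (w : ℝ → E) (n : ℕ) (i : Fin (2 ^ (n + 1))) : E :=
  w (grid a b (n + 1) (i + 1)) - w (grid a b n (i / 2 + 1))

lemma enorm_dyadicIncrement_le {n : ℕ} {β : ℝ≥0∞}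
    (hβ : ∀ i < 2 ^ (n + 1), ‖w (grid a b (n + 1) (i + 1)) - w (grid a b (n + 1) i)‖ₑ ≤ β)
    (i : Fin (2 ^ (n + 1))) : ‖dyadicIncrement a b w n i‖ₑ ≤ β := by
  rw [dyadicIncrement, ← grid_succ_two_mul a b n (i / 2 + 1)]
  rcases Nat.even_or_odd' (i : ℕ) with ⟨q, hq | hq⟩
  · have hlt : (i : ℕ) + 1 < 2 ^ (n + 1) := by have := i.2; have := pow_succ 2 n; lia
    rw [show 2 * ((i : ℕ) / 2 + 1) = i + 1 + 1 by lia, ← enorm_neg, neg_sub]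
    exact hβ _ hlt
  · rw [show 2 * ((i : ℕ) / 2 + 1) = i + 1 by lia, sub_self, enorm_zero]
    exact zero_le

lemma stepFun_dyadicIncrement (w : ℝ → E) (n : ℕ) (hτ : τ ∈ Ico a b) :
    stepFun (fun i : Fin (2 ^ (n + 1) + 1) => grid a b (n + 1) i) (dyadicIncrement a b w n) τ =
      w (grid a b (n + 1) (gridIndex a b (n + 1) τ + 1)) -
        w (grid a b n (gridIndex a b n τ + 1)) := by
  have hmono : Monotone fun i : Fin (2 ^ (n + 1) + 1) => grid a b (n + 1) i :=
    (strictMono_grid (hτ.1.trans_lt hτ.2) _).monotone.comp Fin.val_strictMono.monotone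
  rw [stepFun_eq_of_mem_cell hmono _ (k := ⟨gridIndex a b (n + 1) τ, gridIndex_lt _ hτ⟩)
    (by simpa [cell, gridCell] using mem_gridCell_gridIndex (n + 1) hτ), dyadicIncrement,
    gridIndex_succ_div_two]

lemma ofReal_sqrt_sum_norm_sq_le {ι : Type*} [Fintype ι] {φ : ι → E} {β : ℝ≥0∞}
    (hφ : ∀ k, ‖φ k‖ₑ ≤ β) :
    ENNReal.ofReal √(∑ k, ‖φ k‖ ^ 2) ≤ ENNReal.ofReal √(Fintype.card ι) * β := by
  rcases isEmpty_or_nonempty ι with _ | _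
  · simp
  rcases eq_or_ne β ∞ with rfl | hβ
  · rw [ENNReal.mul_top (by simp [Fintype.card_pos])]
    exact le_top
  have hle (k : ι) : ‖φ k‖ ≤ β.toReal := by simpa using ENNReal.toReal_mono hβ (hφ k)
  rw [← ENNReal.ofReal_toReal hβ, ← ENNReal.ofReal_mul (Real.sqrt_nonneg _)]
  refine ENNReal.ofReal_le_ofReal ?_
  calc √(∑ k, ‖φ k‖ ^ 2) ≤ √(∑ _k : ι, β.toReal ^ 2) := by gcongr with k; exact hle k
    _ = √(Fintype.card ι) * β.toReal := by
        rw [Finset.sum_const, Finset.card_univ, nsmul_eq_mul, Real.sqrt_mul (Nat.cast_nonneg _),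
          Real.sqrt_sq ENNReal.toReal_nonneg]

lemma hasSum_stepFun_dyadicIncrement (hw : ContinuousOn w (Icc a b)) (hwb : w b = 0)
    (hsum : ∑' n, ENNReal.ofReal √(∑ k, ‖dyadicIncrement a b w n k‖ ^ 2) ≠ ∞)
    (hτ : τ ∈ Ico a b) :
    HasSum (fun n => stepFun (fun i : Fin (2 ^ (n + 1) + 1) => grid a b (n + 1) i)
      (dyadicIncrement a b w n) τ) (w τ) := by
  have hab : a < b := hτ.1.trans_lt hτ.2
  have hsummable : Summable fun n => ‖stepFun (fun i : Fin (2 ^ (n + 1) + 1) =>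
      grid a b (n + 1) i) (dyadicIncrement a b w n) τ‖ := by
    refine tsum_enorm_ne_top_iff_summable_norm.1 (ne_top_of_le_ne_top hsum ?_)
    refine ENNReal.tsum_le_tsum fun n => ?_
    rw [← ofReal_norm]
    exact ENNReal.ofReal_le_ofReal (norm_stepFun_le
      ((strictMono_grid hab _).monotone.comp Fin.val_strictMono.monotone) _ τ)
  have hstart : w (grid a b 0 (gridIndex a b 0 τ + 1)) = 0 := by
    have hindex : gridIndex a b 0 τ = 0 := by simpa using gridIndex_lt 0 hτ
    have hlast := grid_two_pow a b 0
    rw [pow_zero] at hlast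
    rw [hindex, zero_add, hlast, hwb]
  rw [hasSum_iff_tendsto_nat_of_summable_norm hsummable]
  simp_rw [stepFun_dyadicIncrement w _ hτ,
    Finset.sum_range_sub (fun n => w (grid a b n (gridIndex a b n τ + 1))), hstart, sub_zero]
  refine (hw τ (Ico_subset_Icc_self hτ)).tendsto.comp
    (tendsto_nhdsWithin_of_tendsto_nhds_of_eventually_within _
      (tendsto_grid_gridIndex_add_one hτ) ?_)
  exact Eventually.of_forall fun n => grid_mem_Icc hab (gridIndex_lt n hτ)

lemma U2norm_le_tsum_of_dyadic_increments [NormedSpace ℂ E] [Nontrivial E] (hab : a < b)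
    (hw : ContinuousOn w (Icc a b)) (hwb : w b = 0) {β : ℕ → ℝ≥0∞}
    (hβ : ∀ n, ∀ i < 2 ^ n, ‖w (grid a b n (i + 1)) - w (grid a b n i)‖ₑ ≤ β n) :
    U2norm a b w ≤ ∑' n, ENNReal.ofReal √(2 ^ n) * β n := by
  have hlevels : ∑' n, ENNReal.ofReal √(∑ k, ‖dyadicIncrement a b w n k‖ ^ 2) ≤
      ∑' n, ENNReal.ofReal √(2 ^ n) * β n := by
    refine (ENNReal.tsum_le_tsum fun n => ?_).trans (ENNReal.tsum_comp_le_tsum_of_injective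
      (add_left_injective 1) fun n => ENNReal.ofReal √(2 ^ n) * β n)
    simpa using ofReal_sqrt_sum_norm_sq_le (enorm_dyadicIncrement_le (hβ (n + 1)))
  rcases eq_or_ne (∑' n, ENNReal.ofReal √(2 ^ n) * β n) ∞ with htop | htop
  · exact htop ▸ le_top
  refine (U2norm_le_tsum_of_hasSum_stepFun hab
    (t := fun n => fun i : Fin (2 ^ (n + 1) + 1) => grid a b (n + 1) i)
    (φ := dyadicIncrement a b w) (fun n => (strictMono_grid hab _).comp Fin.val_strictMono)
    (fun n => by simp [grid_zero]) (fun n => by simpa using grid_two_pow a b (n + 1))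
    fun τ hτ => ?_).trans hlevels
  exact hasSum_stepFun_dyadicIncrement hw hwb (ne_top_of_le_ne_top htop hlevels) hτ

end Chaining

/-! ### Primitives and the space `DU²` -/

section Primitive

variable {E : Type*} [NormedAddCommGroup E] [NormedSpace ℝ E] [CompleteSpace E] {a b : ℝ}
  {f : ℝ → E}

lemma setIntegral_Ioo_smul_primitive {g : ℝ → ℝ} (hg : IntegrableOn g (Ioo a b))
    (hf : IntegrableOn f (Ioo a b)) :
    ∫ t in Ioo a b, g t • ∫ τ in b..t, f τ =
      -∫ τ in Ioo a b, (∫ t in a..τ, g t) • f τ := by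
  set μ := volume.restrict (Ioo a b) with hμ
  set F : ℝ → ℝ → E := fun t τ =>
    {p : ℝ × ℝ | p.1 < p.2}.indicator (fun p => g p.1 • f p.2) (t, τ) with hF
  have hFint : Integrable (Function.uncurry F) (μ.prod μ) :=
    (hg.smul_prod hf).indicator (measurableSet_lt measurable_fst measurable_snd)
  have hinner_right : ∀ t ∈ Ioo a b, g t • ∫ τ in b..t, f τ = -∫ τ, F t τ ∂μ := by
    intro t ht
    have hFt : F t = (Ioi t).indicator fun τ => g t • f τ := by
      funext τ; by_cases h : t < τ <;> simp [hF, h]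
    have hset : Ioo a b ∩ Ioi t = Ioo t b := by
      rw [Ioo_inter_Ioi, max_eq_right ht.1.le]
    rw [hFt, hμ, setIntegral_indicator measurableSet_Ioi, integral_smul, hset,
      ← integral_Ioc_eq_integral_Ioo, ← intervalIntegral.integral_of_le ht.2.le,
      intervalIntegral.integral_symm, smul_neg]
  have hinner_left : ∀ τ ∈ Ioo a b, ∫ t, F t τ ∂μ = (∫ t in a..τ, g t) • f τ := by
    intro τ hτ
    have hFτ : (fun t => F t τ) = (Iio τ).indicator fun t => g t • f τ := by
      funext t; by_cases h : t < τ <;> simp [hF, h]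
    have hset : Ioo a b ∩ Iio τ = Ioo a τ := by
      rw [Ioo_inter_Iio, min_eq_right hτ.2.le]
    rw [hFτ, hμ, setIntegral_indicator measurableSet_Iio, integral_smul_const, hset,
      ← integral_Ioc_eq_integral_Ioo, ← intervalIntegral.integral_of_le hτ.1.le]
  rw [setIntegral_congr_fun measurableSet_Ioo hinner_right, integral_neg,
    integral_integral_swap hFint, setIntegral_congr_fun measurableSet_Ioo hinner_left]

lemma integral_deriv_eq_of_tsupport_subset_Ioo {ψ : ℝ → ℝ} (hψ : ContDiff ℝ 1 ψ)
    (hsupp : tsupport ψ ⊆ Ioo a b) (τ : ℝ) : ∫ t in a..τ, deriv ψ t = ψ τ := by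
  have hψa : ψ a = 0 := image_eq_zero_of_notMem_tsupport fun h => (hsupp h).1.false
  rw [intervalIntegral.integral_deriv_eq_sub (fun x _ => hψ.differentiable one_ne_zero x)
    ((hψ.continuous_deriv le_rfl).intervalIntegrable _ _), hψa, sub_zero]

end Primitive

section DU2

variable {E : Type*} [NormedAddCommGroup E] [NormedSpace ℂ E] [CompleteSpace E] {a b : ℝ}
  {f : ℝ → E}

lemma hasDistribDeriv_primitive (hf : IntegrableOn f (Ioo a b)) :
    HasDistribDeriv a b (fun t => ∫ τ in b..t, f τ) f := by
  refine ⟨hf.locallyIntegrableOn, fun ψ hψ _ hsupp => ?_⟩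
  have hψ1 : ContDiff ℝ 1 ψ := hψ.of_le (by exact_mod_cast le_top)
  have hderiv : IntegrableOn (deriv ψ) (Ioo a b) :=
    (hψ1.continuous_deriv le_rfl).integrableOn_Icc.mono_set Ioo_subset_Icc_self
  simp only [setIntegral_Ioo_smul_primitive hderiv hf,
    integral_deriv_eq_of_tsupport_subset_Ioo hψ1 hsupp]

lemma DU2norm_le_tsum_of_dyadic_integrals [Nontrivial E] (hab : a < b)
    (hf : IntervalIntegrable f volume a b) {β : ℕ → ℝ≥0∞}
    (hβ : ∀ n, ∀ i < 2 ^ n, ‖∫ τ in gridCell a b n i, f τ‖ₑ ≤ β n) :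
    DU2norm a b f ≤ ∑' n, ENNReal.ofReal √(2 ^ n) * β n := by
  have hcont : ContinuousOn (fun t => ∫ τ in b..t, f τ) (Icc a b) := by
    have := intervalIntegral.continuousOn_primitive_interval' hf right_mem_uIcc
    rwa [uIcc_of_le hab.le] at this
  have hsub (n i : ℕ) (hi : i < 2 ^ n) :
      (∫ τ in b..grid a b n (i + 1), f τ) - ∫ τ in b..grid a b n i, f τ =
        ∫ τ in gridCell a b n i, f τ := by
    have hint {x : ℝ} (hx : x ∈ Icc a b) : IntervalIntegrable f volume b x :=
      hf.mono_set (uIcc_subset_uIcc right_mem_uIcc (Icc_subset_uIcc hx))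
    rw [intervalIntegral.integral_interval_sub_left (hint (grid_mem_Icc hab hi))
      (hint (grid_mem_Icc hab hi.le)), intervalIntegral.integral_of_le
      ((strictMono_grid hab n).monotone i.le_succ), gridCell, integral_Ico_eq_integral_Ioc]
  have hzero : Tendsto (fun t => ∫ τ in b..t, f τ) (𝓝[<] b) (𝓝 0) := by
    have := (hcont b (right_mem_Icc.2 hab.le)).tendsto
    rw [intervalIntegral.integral_same] at this
    rw [← nhdsWithin_Ioo_eq_nhdsLT hab]
    exact this.mono_left (nhdsWithin_mono _ Ioo_subset_Icc_self)
  refine iInf_le_of_le _ <| iInf_le_of_le hzero <| iInf_le_of_le (hasDistribDeriv_primitive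
    ((intervalIntegrable_iff_integrableOn_Ioo_of_le hab.le).1 hf)) ?_
  refine U2norm_le_tsum_of_dyadic_increments hab hcont intervalIntegral.integral_same
    fun n i hi => ?_
  rw [hsub n i hi]
  exact hβ n i hi

end DU2

/-! ### The resonance function -/

section Resonance

/-- The resonance function of the interaction of the frequencies `p` and `k - p` into `k`: the
frequency of the time oscillation of that interaction between free waves. -/
def resonance (k p : ℤ) : ℝ := phase k - phase p - phase (k - p)

lemma abs_add_mul_abs_sub_sub_of_mul_nonneg {x y : ℝ} (hxy : 0 ≤ x * y) :
    abs ((x + y) * |x + y| - x * |x| - y * |y|) = 2 * (|x| * |y|) := by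
  rcases mul_nonneg_iff.1 hxy with ⟨hx, hy⟩ | ⟨hx, hy⟩
  · rw [abs_of_nonneg hx, abs_of_nonneg hy, abs_of_nonneg (add_nonneg hx hy),
      abs_of_nonneg (by linarith)]
    ring
  · rw [abs_of_nonpos hx, abs_of_nonpos hy, abs_of_nonpos (add_nonpos hx hy),
      abs_of_nonpos (by linarith)]
    ring

lemma min_mul_max_le_of_add_eq_zero_of_mul_nonneg {x y z : ℝ} (hsum : x + y + z = 0)
    (hxy : 0 ≤ x * y) :
    min |x| (min |y| |z|) * max |x| (max |y| |z|) ≤ abs (x * |x| + y * |y| + z * |z|) := by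
  obtain rfl : z = -(x + y) := by linarith
  have hval : abs (x * |x| + y * |y| + -(x + y) * |-(x + y)|) = 2 * (|x| * |y|) := by
    rw [← abs_add_mul_abs_sub_sub_of_mul_nonneg hxy, ← abs_neg, abs_neg (x + y)]
    ring_nf
  have habs : |-(x + y)| ≤ |x| + |y| := (abs_neg (x + y)).le.trans (abs_add_le x y)
  have hmax : max |x| (max |y| |-(x + y)|) ≤ |x| + |y| :=
    max_le (by simp) (max_le (by simp) habs)
  set m := min |x| (min |y| |-(x + y)|)
  have hm : 0 ≤ m := by simp [m]
  have hmx : m ≤ |x| := min_le_left _ _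
  have hmy : m ≤ |y| := (min_le_right _ _).trans (min_le_left _ _)
  rw [hval]
  calc m * max |x| (max |y| |-(x + y)|) ≤ m * |x| + m * |y| := by
        rw [← mul_add]
        exact mul_le_mul_of_nonneg_left hmax hm
    _ ≤ |y| * |x| + |x| * |y| := by gcongr
    _ = 2 * (|x| * |y|) := by ring

lemma min_mul_max_le_of_add_eq_zero {x y z : ℝ} (hsum : x + y + z = 0) :
    min |x| (min |y| |z|) * max |x| (max |y| |z|) ≤ abs (x * |x| + y * |y| + z * |z|) := by
  -- Two of the three numbers have the same sign.
  have hsign : 0 ≤ x * y ∨ 0 ≤ y * z ∨ 0 ≤ z * x := by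
    by_contra! h
    obtain rfl : z = -(x + y) := by linarith
    nlinarith [sq_nonneg (x + y)]
  rcases hsign with h | h | h
  · exact min_mul_max_le_of_add_eq_zero_of_mul_nonneg hsum h
  · have key := min_mul_max_le_of_add_eq_zero_of_mul_nonneg (z := x) (by linarith) h
    rwa [← min_assoc, ← max_assoc, min_comm _ |x|, max_comm _ |x|, add_comm _ (x * |x|),
      ← add_assoc] at key
  · have key := min_mul_max_le_of_add_eq_zero_of_mul_nonneg (z := y) (by linarith) h
    rwa [min_comm |z|, max_comm |z|, min_assoc, max_assoc, add_assoc, add_comm (z * |z|)] at key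

lemma min_mul_max_le_abs_resonance (k p : ℤ) :
    min |(k : ℝ)| (min |(p : ℝ)| |((k - p : ℤ) : ℝ)|) *
      max |(k : ℝ)| (max |(p : ℝ)| |((k - p : ℤ) : ℝ)|) ≤ |resonance k p| := by
  have key := min_mul_max_le_of_add_eq_zero
    (show -(k : ℝ) + p + ((k - p : ℤ) : ℝ) = 0 by push_cast; ring)
  rw [abs_neg] at key
  refine key.trans_eq (congrArg abs ?_)
  rw [resonance, phase, phase, phase]
  ring

lemma norm_integral_exp_le {ω c d : ℝ} (hω : ω ≠ 0) (hcd : c ≤ d) :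
    ‖∫ τ in Ico c d, Complex.exp (-(Complex.I * τ * ω))‖ ≤ √(2 * (d - c) / |ω|) := by
  have hexponent (τ : ℝ) : -(Complex.I * τ * ω) = -(Complex.I * ω) * τ := by ring
  have hnorm (τ : ℝ) : ‖Complex.exp (-(Complex.I * τ * ω))‖ = 1 := by
    rw [show -(Complex.I * τ * ω) = ((-(τ * ω) : ℝ) : ℂ) * Complex.I by push_cast; ring,
      Complex.norm_exp_ofReal_mul_I]
  have htrivial : ‖∫ τ in Ico c d, Complex.exp (-(Complex.I * τ * ω))‖ ≤ d - c := by
    simpa [hcd] using norm_setIntegral_le_of_norm_le_const (μ := volume) (s := Ico c d) (C := 1)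
      (by simp) fun τ _ => (hnorm τ).le
  have hoscillation : ‖∫ τ in Ico c d, Complex.exp (-(Complex.I * τ * ω))‖ ≤ 2 / |ω| := by
    rw [integral_Ico_eq_integral_Ioc, ← intervalIntegral.integral_of_le hcd]
    simp_rw [hexponent]
    rw [integral_exp_mul_complex (by simp [hω]), norm_div, norm_neg, norm_mul, Complex.norm_I,
      one_mul, Complex.norm_real, Real.norm_eq_abs]
    gcongr
    refine (norm_sub_le _ _).trans_eq ?_
    rw [← hexponent, ← hexponent, hnorm, hnorm, one_add_one_eq_two]
  refine Real.le_sqrt_of_sq_le ?_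
  calc _ ≤ (d - c) * (2 / |ω|) := by
        rw [sq]
        exact mul_le_mul htrivial hoscillation (norm_nonneg _) (sub_nonneg.2 hcd)
    _ = 2 * (d - c) / |ω| := by ring

end Resonance

/-! ### Convolutions and bilinear Fourier multipliers -/

section Convolution

variable {G : Type*} [AddCommGroup G] [DecidableEq G] {f g : G → ℝ} {A B : ℝ}

lemma sum_sq_sum_mul_sub_le_card_mul (S S₁ S₂ : Finset G)
    (hf : ∀ s : Finset G, ∑ p ∈ s, f p ^ 2 ≤ A) (hg : ∀ s : Finset G, ∑ p ∈ s, g p ^ 2 ≤ B) :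
    ∑ k ∈ S, (∑ p ∈ S₁ with k - p ∈ S₂, f p * g (k - p)) ^ 2 ≤ S.card * (A * B) := by
  have hA : 0 ≤ A := by simpa using hf ∅
  have hsub (k : G) (s : Finset G) : ∑ p ∈ s, g (k - p) ^ 2 ≤ B := by
    simpa using hg (s.map (Equiv.subLeft k).toEmbedding)
  rw [← nsmul_eq_mul]
  refine Finset.sum_le_card_nsmul _ _ _ fun k _ =>
    (Finset.sum_mul_sq_le_sq_mul_sq _ _ _).trans ?_
  exact mul_le_mul (hf _) (hsub k _) (Finset.sum_nonneg fun p _ => sq_nonneg _) hA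

lemma sum_sq_sum_mul_sub_le_min_card_mul (S S₁ S₂ : Finset G)
    (hf : ∀ s : Finset G, ∑ p ∈ s, f p ^ 2 ≤ A) (hg : ∀ s : Finset G, ∑ p ∈ s, g p ^ 2 ≤ B) :
    ∑ k ∈ S, (∑ p ∈ S₁ with k - p ∈ S₂, f p * g (k - p)) ^ 2 ≤
      (min S₁.card S₂.card : ℕ) * (A * B) := by
  have hB : 0 ≤ B := by simpa using hg ∅
  have hsub (p : G) : ∑ k ∈ S, g (k - p) ^ 2 ≤ B := by
    simpa using hg (S.map (Equiv.subRight p).toEmbedding)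
  have hcard (k : G) : (S₁.filter fun p => k - p ∈ S₂).card ≤ min S₁.card S₂.card :=
    le_min (Finset.card_filter_le _ _) <| Finset.card_le_card_of_injOn (k - ·)
      (fun p hp => (Finset.mem_filter.1 hp).2) (sub_right_injective.injOn)
  calc ∑ k ∈ S, (∑ p ∈ S₁ with k - p ∈ S₂, f p * g (k - p)) ^ 2
      ≤ ∑ k ∈ S, (min S₁.card S₂.card : ℕ) * ∑ p ∈ S₁, (f p * g (k - p)) ^ 2 := by
        gcongr with k
        refine sq_sum_le_card_mul_sum_sq.trans ?_
        gcongr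
        · exact hcard k
        · exact Finset.filter_subset _ _
    _ = (min S₁.card S₂.card : ℕ) * ∑ p ∈ S₁, f p ^ 2 * ∑ k ∈ S, g (k - p) ^ 2 := by
        rw [← Finset.mul_sum, Finset.sum_comm]
        simp_rw [mul_pow, ← Finset.mul_sum]
    _ ≤ (min S₁.card S₂.card : ℕ) * (A * B) := by
        gcongr
        calc ∑ p ∈ S₁, f p ^ 2 * ∑ k ∈ S, g (k - p) ^ 2 ≤ ∑ p ∈ S₁, f p ^ 2 * B := by
              gcongr with p
              exact hsub p
          _ ≤ A * B := by
              rw [← Finset.sum_mul]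
              exact mul_le_mul_of_nonneg_right (hf S₁) hB

end Convolution

section Multiplier

/-- The `k`-th Fourier coefficient, as a continuous functional on `L²(𝕋)`. -/
def coeff (k : ℤ) : L2T →L[ℂ] ℂ := innerSL ℂ (fourierLp 2 k : L2T)

lemma coeff_eq_repr (k : ℤ) (x : L2T) : coeff k x = fourierBasis.repr x k := by
  rw [fourierBasis.repr_apply_apply, coe_fourierBasis, coeff, innerSL_apply_apply]

lemma sum_norm_coeff_sq_le (S : Finset ℤ) (x : L2T) : ∑ k ∈ S, ‖coeff k x‖ ^ 2 ≤ ‖x‖ ^ 2 := by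
  simpa [coeff] using (orthonormal_fourier (T := 2 * Real.pi)).sum_inner_products_le x (s := S)

lemma norm_sum_smul_fourierLp_sq (S : Finset ℤ) (c : ℤ → ℂ) :
    ‖∑ k ∈ S, c k • (fourierLp 2 k : L2T)‖ ^ 2 = ∑ k ∈ S, ‖c k‖ ^ 2 := by
  have hinner := (orthonormal_fourier (T := 2 * Real.pi)).inner_sum c c S
  simp_rw [inner_self_eq_norm_sq_to_K, Complex.conj_mul'] at hinner
  refine Complex.ofReal_injective (Eq.trans ?_ (hinner.trans ?_)) <;> push_cast <;> rfl

lemma sum_sq_sum_norm_coeff_mul_le (S S₁ S₂ : Finset ℤ) (x y : L2T) :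
    ∑ k ∈ S, (∑ p ∈ S₁ with k - p ∈ S₂, ‖coeff p x‖ * ‖coeff (k - p) y‖) ^ 2 ≤
      (min S.card (min S₁.card S₂.card) : ℕ) * (‖x‖ * ‖y‖) ^ 2 := by
  rw [mul_pow]
  rcases min_choice S.card (min S₁.card S₂.card) with h | h <;> rw [h]
  · exact sum_sq_sum_mul_sub_le_card_mul (f := (‖coeff · x‖)) (g := (‖coeff · y‖)) S S₁ S₂
      (sum_norm_coeff_sq_le · x) (sum_norm_coeff_sq_le · y)
  · exact sum_sq_sum_mul_sub_le_min_card_mul (f := (‖coeff · x‖)) (g := (‖coeff · y‖)) S S₁ S₂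
      (sum_norm_coeff_sq_le · x) (sum_norm_coeff_sq_le · y)

/-- The bilinear Fourier multiplier with symbol `m`, restricted to output frequencies in `S` and
input frequencies in `S₁` and `S₂`: its value at `(x, y)` has the Fourier coefficients
`∑ p, m k p * x̂ p * ŷ (k - p)`. -/
def bilinMult (S S₁ S₂ : Finset ℤ) (m : ℤ → ℤ → ℂ) : L2T →L[ℂ] L2T →L[ℂ] L2T :=
  ∑ k ∈ S, ∑ p ∈ S₁ with k - p ∈ S₂,
    m k p • (coeff p).smulRight ((coeff (k - p)).smulRight (fourierLp 2 k : L2T))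

lemma bilinMult_apply (S S₁ S₂ : Finset ℤ) (m : ℤ → ℤ → ℂ) (x y : L2T) :
    bilinMult S S₁ S₂ m x y = ∑ k ∈ S, (∑ p ∈ S₁ with k - p ∈ S₂,
      m k p * (coeff p x * coeff (k - p) y)) • (fourierLp 2 k : L2T) := by
  simp only [bilinMult, sum_apply, _root_.smul_apply,
    ContinuousLinearMap.smulRight_apply, Finset.sum_smul, mul_smul]

lemma norm_bilinMult_le {S S₁ S₂ : Finset ℤ} {m : ℤ → ℤ → ℂ} {D : ℝ}
    (hm : ∀ k ∈ S, ∀ p ∈ S₁, k - p ∈ S₂ → ‖m k p‖ ≤ D) (hD : 0 ≤ D) (x y : L2T) :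
    ‖bilinMult S S₁ S₂ m x y‖ ≤
      D * √(min S.card (min S₁.card S₂.card) : ℕ) * ‖x‖ * ‖y‖ := by
  refine (sq_le_sq₀ (norm_nonneg _) (by positivity)).1 ?_
  rw [bilinMult_apply, norm_sum_smul_fourierLp_sq]
  calc _ ≤ ∑ k ∈ S, (D * ∑ p ∈ S₁ with k - p ∈ S₂, ‖coeff p x‖ * ‖coeff (k - p) y‖) ^ 2 := by
        gcongr with k hk
        rw [Finset.mul_sum]
        refine norm_sum_le_of_le _ fun p hp => ?_
        rw [Finset.mem_filter] at hp
        rw [norm_mul, norm_mul]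
        gcongr
        exact hm k hk p hp.1 hp.2
    _ = D ^ 2 * ∑ k ∈ S, (∑ p ∈ S₁ with k - p ∈ S₂, ‖coeff p x‖ * ‖coeff (k - p) y‖) ^ 2 := by
        simp_rw [mul_pow, Finset.mul_sum]
    _ ≤ D ^ 2 * ((min S.card (min S₁.card S₂.card) : ℕ) * (‖x‖ * ‖y‖) ^ 2) := by
        gcongr
        exact sum_sq_sum_norm_coeff_mul_le S S₁ S₂ x y
    _ = _ := by
        rw [mul_assoc (D * _), mul_pow (D * _), mul_pow D, Real.sq_sqrt (by positivity)]
        ring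

end Multiplier

/-! ### Dyadic frequency blocks -/

section DyadicBlocks

variable {j j₁ j₂ : ℕ} {k p : ℤ}

lemma mem_freqs : k ∈ freqs j ↔ Nat.log 2 k.natAbs = j := by
  have hlt : k ∈ Finset.Ioo (-(2 : ℤ) ^ (j + 1)) (2 ^ (j + 1)) ↔ k.natAbs < 2 ^ (j + 1) := by
    rw [Finset.mem_Ioo, ← abs_lt, Int.abs_eq_natAbs]
    exact_mod_cast Iff.rfl
  have hle : (2 : ℤ) ^ j ≤ |k| ↔ 2 ^ j ≤ k.natAbs := by
    rw [Int.abs_eq_natAbs]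
    exact_mod_cast Iff.rfl
  rw [freqs, Finset.mem_filter, hlt, hle]
  rcases eq_or_ne j 0 with rfl | hj
  · simp [Nat.log_eq_zero_iff]
  · rw [Nat.log_eq_iff (Or.inl hj), and_comm]
    simp only [hj, false_or]

lemma abs_le_of_mem_freqs (hk : k ∈ freqs j) : |(k : ℝ)| ≤ 2 ^ (j + 1) := by
  have h := (Finset.mem_filter.1 hk).1
  rw [Finset.mem_Ioo, ← abs_lt] at h
  exact_mod_cast h.le

lemma le_abs_of_mem_freqs (hj : j ≠ 0) (hk : k ∈ freqs j) : (2 : ℝ) ^ j ≤ |(k : ℝ)| := by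
  exact_mod_cast (Finset.mem_filter.1 hk).2.resolve_left hj

lemma card_freqs_le (j : ℕ) : (freqs j).card ≤ 2 ^ (j + 2) := by
  refine (Finset.card_filter_le _ _).trans ?_
  rw [Int.card_Ioo, Int.toNat_le]
  push_cast
  rw [pow_succ _ (j + 1)]
  linarith

/-- The triples of dyadic frequencies `2 ^ j`, `2 ^ j₁`, `2 ^ j₂` for which the product of two
blocks at `j₁` and `j₂` can have a frequency in the block at `j`: the two largest frequencies are
comparable. -/
def Interacts (j j₁ j₂ : ℕ) : Prop :=
  j ≤ max j₁ j₂ + 1 ∧ j₁ ≤ max j j₂ + 1 ∧ j₂ ≤ max j j₁ + 1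

instance (j j₁ j₂ : ℕ) : Decidable (Interacts j j₁ j₂) :=
  inferInstanceAs (Decidable (_ ∧ _ ∧ _))

lemma log_natAbs_add_le (a b : ℤ) :
    Nat.log 2 (a + b).natAbs ≤ max (Nat.log 2 a.natAbs) (Nat.log 2 b.natAbs) + 1 := by
  set M := max (Nat.log 2 a.natAbs) (Nat.log 2 b.natAbs)
  have hlt {n : ℕ} (hn : Nat.log 2 n ≤ M) : n < 2 ^ (M + 1) :=
    Nat.lt_pow_of_log_lt one_lt_two (Nat.lt_succ_of_le hn)
  have ha := hlt (le_max_left _ _ : Nat.log 2 a.natAbs ≤ M)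
  have hb := hlt (le_max_right _ _ : Nat.log 2 b.natAbs ≤ M)
  have hadd : (a + b).natAbs < 2 ^ (M + 1 + 1) := by
    have := Int.natAbs_add_le a b
    have := pow_succ 2 (M + 1)
    lia
  exact Nat.lt_succ_iff.1 (Nat.log_lt_of_lt_pow' (by lia) hadd)

lemma interacts_of_mem_freqs (hk : k ∈ freqs j) (hp : p ∈ freqs j₁) (hq : k - p ∈ freqs j₂) :
    Interacts j j₁ j₂ := by
  rw [mem_freqs] at hk hp hq
  have hk_le := log_natAbs_add_le p (k - p)
  have hp_le := log_natAbs_add_le k (-(k - p))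
  have hq_le := log_natAbs_add_le k (-p)
  rw [add_sub_cancel] at hk_le
  rw [Int.natAbs_neg, show k + -(k - p) = p by ring] at hp_le
  rw [Int.natAbs_neg, ← sub_eq_add_neg] at hq_le
  rw [← hk, ← hp, ← hq]
  exact ⟨hk_le, hp_le, hq_le⟩

lemma two_pow_min_mul_two_pow_max_le_abs_resonance (hj : j ≠ 0) (hj₁ : j₁ ≠ 0) (hj₂ : j₂ ≠ 0)
    (hk : k ∈ freqs j) (hp : p ∈ freqs j₁) (hq : k - p ∈ freqs j₂) :
    (2 : ℝ) ^ min j (min j₁ j₂) * 2 ^ max j (max j₁ j₂) ≤ |resonance k p| := by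
  have hmono : Monotone fun n : ℕ => (2 : ℝ) ^ n := pow_right_mono₀ one_le_two
  have hk' := le_abs_of_mem_freqs hj hk
  have hp' := le_abs_of_mem_freqs hj₁ hp
  have hq' := le_abs_of_mem_freqs hj₂ hq
  rw [hmono.map_min, hmono.map_min, hmono.map_max, hmono.map_max]
  refine le_trans ?_ (min_mul_max_le_abs_resonance k p)
  gcongr

lemma sqrt_min_card_freqs_le (j j₁ j₂ : ℕ) :
    √(min (freqs j).card (min (freqs j₁).card (freqs j₂).card) : ℕ) ≤
      2 * √(2 ^ min j (min j₁ j₂)) := by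
  have hmono : Monotone fun n : ℕ => 2 ^ (n + 2) := fun m n h =>
    Nat.pow_le_pow_right two_pos (by lia)
  have hcard : min (freqs j).card (min (freqs j₁).card (freqs j₂).card) ≤
      2 ^ (min j (min j₁ j₂) + 2) := by
    rw [hmono.map_min, hmono.map_min]
    gcongr <;> exact card_freqs_le _
  refine Real.sqrt_le_iff.2 ⟨by positivity, ?_⟩
  rw [mul_pow, Real.sq_sqrt (by positivity), mul_comm, ← pow_add]
  exact_mod_cast hcard

end DyadicBlocks

/-! ### The dyadic interactions -/

section Interaction

variable {j j₁ j₂ : ℕ}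

/-- The symbol of the bilinear form `∂ₓ(uv)` at time `τ` in terms of the profiles
`e^{-iτφ(∂ₓ/i)}u(τ)` and `e^{-iτφ(∂ₓ/i)}v(τ)`. -/
def symbol (τ : ℝ) (k p : ℤ) : ℂ :=
  Complex.I * k * Complex.exp (-(Complex.I * τ * resonance k p))

/-- The part of `∂ₓ(uv)` at time `τ` with output frequency `2 ^ j` and input frequencies `2 ^ j₁`
and `2 ^ j₂`, as a bilinear form of the profiles of `u` and `v`. -/
def interaction (j j₁ j₂ : ℕ) (τ : ℝ) : L2T →L[ℂ] L2T →L[ℂ] L2T :=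
  bilinMult (freqs j) (freqs j₁) (freqs j₂) (symbol τ)

lemma interaction_eq_zero (h : ¬ Interacts j j₁ j₂) (τ : ℝ) : interaction j j₁ j₂ τ = 0 := by
  rw [interaction, bilinMult]
  refine Finset.sum_eq_zero fun k hk => Finset.sum_eq_zero fun p hp => ?_
  rw [Finset.mem_filter] at hp
  exact absurd (interacts_of_mem_freqs hk hp.1 hp.2) h

lemma continuous_symbol (k p : ℤ) : Continuous fun τ => symbol τ k p := by
  unfold symbol; fun_prop

lemma continuous_interaction (j j₁ j₂ : ℕ) : Continuous (interaction j j₁ j₂) := by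
  unfold interaction bilinMult
  exact continuous_finsetSum _ fun k _ => continuous_finsetSum _ fun p _ =>
    (continuous_symbol k p).smul continuous_const

lemma norm_symbol (τ : ℝ) (k p : ℤ) : ‖symbol τ k p‖ = |(k : ℝ)| := by
  have hexponent :
      -(Complex.I * τ * resonance k p) = ((-(τ * resonance k p) : ℝ) : ℂ) * Complex.I := by
    push_cast; ring
  rw [symbol, hexponent, norm_mul, Complex.norm_exp_ofReal_mul_I]
  simp

lemma norm_bilinMult_freqs_le {m : ℤ → ℤ → ℂ} {D : ℝ} (hD : 0 ≤ D)
    (hm : ∀ k ∈ freqs j, ∀ p ∈ freqs j₁, k - p ∈ freqs j₂ → ‖m k p‖ ≤ 2 ^ (j + 1) * D)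
    (x y : L2T) :
    ‖bilinMult (freqs j) (freqs j₁) (freqs j₂) m x y‖ ≤
      4 * 2 ^ j * √(2 ^ min j (min j₁ j₂)) * D * ‖x‖ * ‖y‖ := by
  refine (norm_bilinMult_le hm (by positivity) x y).trans ?_
  gcongr ?_ * ‖x‖ * ‖y‖
  calc _ ≤ 2 ^ (j + 1) * D * (2 * √(2 ^ min j (min j₁ j₂))) := by
        gcongr
        exact sqrt_min_card_freqs_le j j₁ j₂
    _ = 4 * 2 ^ j * √(2 ^ min j (min j₁ j₂)) * D := by rw [pow_succ]; ring

lemma norm_interaction_le (j j₁ j₂ : ℕ) (τ : ℝ) (x y : L2T) :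
    ‖interaction j j₁ j₂ τ x y‖ ≤ 4 * 2 ^ j * √(2 ^ min j (min j₁ j₂)) * ‖x‖ * ‖y‖ := by
  simpa [interaction] using norm_bilinMult_freqs_le zero_le_one (m := symbol τ)
    (fun k hk p _ _ => by simpa [norm_symbol] using abs_le_of_mem_freqs hk) x y

lemma setIntegral_interaction_apply (j j₁ j₂ : ℕ) (x y : L2T) (c d : ℝ) :
    ∫ τ in Ico c d, interaction j j₁ j₂ τ x y =
      bilinMult (freqs j) (freqs j₁) (freqs j₂) (fun k p => ∫ τ in Ico c d, symbol τ k p) x y := by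
  have hint (k p : ℤ) : IntegrableOn (fun τ => symbol τ k p) (Ico c d) :=
    (continuous_symbol k p).integrableOn_Icc.mono_set Ico_subset_Icc_self
  simp only [interaction, bilinMult_apply]
  rw [integral_finsetSum _ fun k _ =>
    (integrable_finsetSum _ fun p _ => (hint k p).mul_const _).smul_const _]
  refine Finset.sum_congr rfl fun k _ => ?_
  rw [integral_smul_const, integral_finsetSum _ fun p _ => (hint k p).mul_const _]
  simp_rw [integral_mul_const]

lemma norm_setIntegral_symbol_le (hj : j ≠ 0) (hj₁ : j₁ ≠ 0) (hj₂ : j₂ ≠ 0) {k p : ℤ}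
    (hk : k ∈ freqs j) (hp : p ∈ freqs j₁) (hq : k - p ∈ freqs j₂) {c d : ℝ} (hcd : c ≤ d) :
    ‖∫ τ in Ico c d, symbol τ k p‖ ≤
      2 ^ (j + 1) * √(2 * (d - c) / (2 ^ min j (min j₁ j₂) * 2 ^ max j (max j₁ j₂))) := by
  have hres := two_pow_min_mul_two_pow_max_le_abs_resonance hj hj₁ hj₂ hk hp hq
  have hne : resonance k p ≠ 0 := abs_pos.1 (lt_of_lt_of_le (by positivity) hres)
  simp only [symbol]
  rw [integral_const_mul, norm_mul]
  gcongr
  · simpa using abs_le_of_mem_freqs hk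
  · exact (norm_integral_exp_le hne hcd).trans (by gcongr)

lemma norm_setIntegral_interaction_le (hj : j ≠ 0) (hj₁ : j₁ ≠ 0) (hj₂ : j₂ ≠ 0) (x y : L2T)
    {c d : ℝ} (hcd : c ≤ d) :
    ‖∫ τ in Ico c d, interaction j j₁ j₂ τ x y‖ ≤
      8 * 2 ^ j / √(2 ^ max j (max j₁ j₂)) * √(d - c) * ‖x‖ * ‖y‖ := by
  have hsqrt2 : √2 ≤ 2 := Real.sqrt_le_iff.2 (by norm_num)
  rw [setIntegral_interaction_apply]
  refine (norm_bilinMult_freqs_le (Real.sqrt_nonneg _) (fun k hk p hp hq =>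
    norm_setIntegral_symbol_le hj hj₁ hj₂ hk hp hq hcd) x y).trans ?_
  gcongr ?_ * ‖x‖ * ‖y‖
  set l := min j (min j₁ j₂)
  set M := max j (max j₁ j₂)
  calc 4 * 2 ^ j * √(2 ^ l) * √(2 * (d - c) / (2 ^ l * 2 ^ M))
      = 4 * √2 * 2 ^ j / √(2 ^ M) * √(d - c) := by
        rw [Real.sqrt_div (by positivity), Real.sqrt_mul (by positivity),
          Real.sqrt_mul (by positivity)]
        field_simp
    _ ≤ 4 * 2 * 2 ^ j / √(2 ^ M) * √(d - c) := by gcongr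
    _ = 8 * 2 ^ j / √(2 ^ M) * √(d - c) := by norm_num

end Interaction

/-! ### Dyadic decomposition of the nonlinearity -/

section Decomposition

/-- The profile `e^{-itφ(∂ₓ/i)} P_N u(t)` of the dyadic block of `u` at frequency `N = 2 ^ j`. -/
def profile (j : ℕ) (u : ℝ → L2T) (t : ℝ) : L2T :=
  flow (-t) (dyadicProj j (fourierCoeff (u t)))

lemma ext_coeff {x y : L2T} (h : ∀ k, coeff k x = coeff k y) : x = y := by
  refine fourierBasis.repr.injective (lp.ext (funext fun k => ?_))
  rw [← coeff_eq_repr, ← coeff_eq_repr, h]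

lemma coeff_dyadicProj (j : ℕ) (c : ℤ → ℂ) (k : ℤ) :
    coeff k (dyadicProj j c) = if k ∈ freqs j then c k else 0 := by
  have horthonormal := orthonormal_iff_ite.1 (orthonormal_fourier (T := 2 * Real.pi))
  simp only [dyadicProj, map_sum, map_smul, coeff, innerSL_apply_apply, horthonormal, smul_eq_mul,
    mul_ite, mul_one, mul_zero, Finset.sum_ite_eq]

lemma coeff_flow (t : ℝ) (f : L2T) (k : ℤ) :
    coeff k (flow t f) = Complex.exp (Complex.I * t * phase k) * coeff k f := by
  rw [coeff_eq_repr, coeff_eq_repr, flow, LinearIsometryEquiv.apply_symm_apply]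

lemma flow_dyadicProj (t : ℝ) (j : ℕ) (c : ℤ → ℂ) :
    flow t (dyadicProj j c) =
      dyadicProj j fun k => Complex.exp (Complex.I * t * phase k) * c k := by
  refine ext_coeff fun k => ?_
  rw [coeff_flow, coeff_dyadicProj, coeff_dyadicProj, mul_ite, mul_zero]

lemma coeff_profile {j : ℕ} {k : ℤ} (hk : k ∈ freqs j) (u : ℝ → L2T) (t : ℝ) :
    coeff k (profile j u t) =
      Complex.exp (Complex.I * ((-t : ℝ) : ℂ) * phase k) * fourierCoeff (u t) k := by
  rw [profile, coeff_flow, coeff_dyadicProj, if_pos hk]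

lemma memLp_conj_mul_fourier (g : L2T) (k : ℤ) :
    MemLp (fun x : Circ => (starRingEnd ℂ) (g x) * fourier k x) 2
      (AddCircle.haarAddCircle (T := 2 * Real.pi)) :=
  (Lp.memLp g).of_le
    ((Complex.continuous_conj.comp_aestronglyMeasurable (Lp.memLp g).1).mul
      (fourier k).continuous.aestronglyMeasurable)
    (Eventually.of_forall fun x => by simp [fourier_apply, Circle.norm_coe])

lemma hasSum_fourierCoeff_mul (f g : L2T) (k : ℤ) :
    HasSum (fun p => fourierCoeff f p * fourierCoeff g (k - p))
      (fourierCoeff (fun x : Circ => f x * g x) k) := by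
  -- Parseval's identity for the inner product of `ḡ e^{ikx}` and `f`.
  set h : L2T := (memLp_conj_mul_fourier g k).toLp _ with hh
  have hae := (memLp_conj_mul_fourier g k).coeFn_toLp
  have parseval := fourierBasis.hasSum_inner_mul_inner h f
  have inner_h_f : inner ℂ h f = fourierCoeff (fun x : Circ => f x * g x) k := by
    rw [L2.inner_def, fourierCoeff]
    refine integral_congr_ae ?_
    filter_upwards [hae] with x hx
    rw [hh, hx]
    simp only [RCLike.inner_apply, map_mul, Complex.conj_conj, smul_eq_mul, fourier_neg]
    ring
  have inner_h_basis (p : ℤ) : inner ℂ h (fourierBasis p : L2T) = fourierCoeff g (k - p) := by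
    rw [coe_fourierBasis, L2.inner_def, fourierCoeff]
    refine integral_congr_ae ?_
    filter_upwards [hae, coeFn_fourierLp (T := 2 * Real.pi) 2 p] with x hx hp
    rw [hh, hx, hp]
    simp only [RCLike.inner_apply, map_mul, Complex.conj_conj, smul_eq_mul, neg_sub]
    rw [sub_eq_add_neg, fourier_add, fourier_neg]
    ring
  have inner_basis_f (p : ℤ) : inner ℂ (fourierBasis p : L2T) f = fourierCoeff f p := by
    rw [← fourierBasis.repr_apply_apply, fourierBasis_repr]
  rw [inner_h_f] at parseval
  simpa only [inner_h_basis, inner_basis_f, mul_comm] using parseval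

lemma hasSum_freqs_fourierCoeff_mul (f g : L2T) (k : ℤ) :
    HasSum (fun q : ℕ × ℕ => ∑ p ∈ freqs q.1 with k - p ∈ freqs q.2,
      fourierCoeff f p * fourierCoeff g (k - p)) (fourierCoeff (fun x : Circ => f x * g x) k) := by
  refine ((hasSum_fourierCoeff_mul f g k).tsum_fiberwise
    fun p => (Nat.log 2 p.natAbs, Nat.log 2 (k - p).natAbs)).congr_fun fun q => ?_
  have hfiber : (fun p : ℤ => (Nat.log 2 p.natAbs, Nat.log 2 (k - p).natAbs)) ⁻¹' {q} =
      ((freqs q.1).filter fun p => k - p ∈ freqs q.2 : Finset ℤ) := by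
    ext p
    simp [mem_freqs, Prod.ext_iff]
  rw [hfiber, Finset.tsum_subtype' _ fun p => fourierCoeff f p * fourierCoeff g (k - p)]

lemma symbol_mul_coeff_profile_mul_coeff_profile {j₁ j₂ : ℕ} {k p : ℤ} (hp : p ∈ freqs j₁)
    (hq : k - p ∈ freqs j₂) (u v : ℝ → L2T) (t : ℝ) :
    symbol t k p * (coeff p (profile j₁ u t) * coeff (k - p) (profile j₂ v t)) =
      Complex.exp (Complex.I * ((-t : ℝ) : ℂ) * phase k) * (Complex.I * k) *
        (fourierCoeff (u t) p * fourierCoeff (v t) (k - p)) := by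
  have hexp : Complex.exp (-(Complex.I * t * resonance k p)) *
      (Complex.exp (Complex.I * ((-t : ℝ) : ℂ) * phase p) *
        Complex.exp (Complex.I * ((-t : ℝ) : ℂ) * phase (k - p))) =
      Complex.exp (Complex.I * ((-t : ℝ) : ℂ) * phase k) := by
    rw [← Complex.exp_add, ← Complex.exp_add, resonance]
    congr 1
    push_cast; ring
  rw [coeff_profile hp, coeff_profile hq, symbol, ← hexp]
  ring

lemma hasSum_interaction_profile (j : ℕ) (u v : ℝ → L2T) (t : ℝ) :
    HasSum (fun q : ℕ × ℕ => interaction j q.1 q.2 t (profile q.1 u t) (profile q.2 v t))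
      (flow (-t) (dyadicProj j (dxMul u v t))) := by
  rw [flow_dyadicProj, dyadicProj]
  simp only [interaction, bilinMult_apply]
  refine hasSum_sum fun k _ => HasSum.smul_const ?_ _
  rw [dxMul, ← mul_assoc]
  refine ((hasSum_freqs_fourierCoeff_mul (u t) (v t) k).mul_left _).congr_fun fun q => ?_
  rw [Finset.mul_sum]
  refine Finset.sum_congr rfl fun p hp => ?_
  rw [Finset.mem_filter] at hp
  exact symbol_mul_coeff_profile_mul_coeff_profile hp.1 hp.2 u v t

end Decomposition

/-! ### Short-time bounds for the interaction of two blocks -/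

section Block

variable {T t : ℝ} {j j₁ j₂ : ℕ} {u v : ℝ → L2T}

lemma window_pos (hT : 0 < T) (j : ℕ) : 0 < window T j := lt_min (by positivity) hT

lemma window_le (T : ℝ) (j : ℕ) : window T j ≤ T := min_le_right _ _

lemma window_le_inv_two_pow (T : ℝ) (j : ℕ) : window T j ≤ (2 ^ j)⁻¹ := min_le_left _ _

/-- The supremum of the `U²`-norms of the profile of the dyadic block of `u` at frequency `2 ^ j`
over the intervals of length `window T j` in `[0, T)`. -/
def blockNorm (T : ℝ) (j : ℕ) (u : ℝ → L2T) : ℝ≥0∞ :=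
  ⨆ (a : ℝ) (_ : 0 ≤ a) (_ : a + window T j ≤ T), U2norm a (a + window T j) (profile j u)

lemma U2norm_le_blockNorm {a : ℝ} (ha : 0 ≤ a) (hb : a + window T j ≤ T) :
    U2norm a (a + window T j) (profile j u) ≤ blockNorm T j u :=
  le_iSup₂_of_le a ha <| le_iSup_of_le hb le_rfl

lemma exists_window_superset {c d : ℝ} (hc : 0 ≤ c) (hd : d ≤ T) (hcd : d - c ≤ window T j) :
    ∃ a, 0 ≤ a ∧ a + window T j ≤ T ∧ Ico c d ⊆ Ico a (a + window T j) := by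
  rcases le_total c (T - window T j) with h | h
  · exact ⟨c, hc, by linarith, Ico_subset_Ico le_rfl (by linarith)⟩
  · exact ⟨T - window T j, sub_nonneg.2 (window_le T j), by linarith,
      Ico_subset_Ico h (by linarith)⟩

lemma enorm_profile_le (hT : 0 < T) (ht : t ∈ Ico 0 T) :
    ‖profile j u t‖ₑ ≤ blockNorm T j u := by
  have hw := window_pos hT j
  obtain ⟨a, ha, hb, hsub⟩ := exists_window_superset (j := j) (c := t) (d := min T (t + window T j))
    ht.1 (min_le_left _ _) (by linarith [min_le_right T (t + window T j)])
  have hmem : t ∈ Ico a (a + window T j) := hsub ⟨le_rfl, lt_min ht.2 (by linarith)⟩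
  exact (enorm_le_U2norm _ hmem).trans (U2norm_le_blockNorm ha hb)

lemma aestronglyMeasurable_profile (hT : 0 < T) (h : blockNorm T j u ≠ ∞) :
    AEStronglyMeasurable (profile j u) (volume.restrict (Ico 0 T)) := by
  have hcover : Ico 0 T ⊆
      ⋃ n : ℤ, Ico (max 0 (n • window T j)) (min T ((n + 1) • window T j)) := by
    intro τ hτ
    have hpieces := iUnion_Ico_zsmul (window_pos hT j)
    obtain ⟨n, hn⟩ := mem_iUnion.1 (hpieces.ge (mem_univ τ))
    exact mem_iUnion.2 ⟨n, max_le hτ.1 hn.1, lt_min hτ.2 hn.2⟩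
  refine AEStronglyMeasurable.mono_set hcover ?_
  rw [aestronglyMeasurable_iUnion_iff]
  intro n
  obtain ⟨a, ha, hb, hsub⟩ := exists_window_superset (T := T) (j := j)
    (le_max_left 0 (n • window T j)) (min_le_left T ((n + 1) • window T j)) (by
      have hstep : (n + 1) • window T j - n • window T j = window T j := by
        rw [add_zsmul, one_zsmul, add_sub_cancel_left]
      linarith [min_le_right T ((n + 1) • window T j), le_max_right 0 (n • window T j)])
  exact (aestronglyMeasurable_of_U2norm_ne_top
    (ne_top_of_le_ne_top h (U2norm_le_blockNorm ha hb))).mono_set hsub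

/-- The contribution to `e^{-itφ(∂ₓ/i)} P_N ∂ₓ(uv)`, `N = 2 ^ j`, of the dyadic blocks of `u` and
`v` at frequencies `2 ^ j₁` and `2 ^ j₂`. -/
def blockTerm (j j₁ j₂ : ℕ) (u v : ℝ → L2T) (t : ℝ) : L2T :=
  interaction j j₁ j₂ t (profile j₁ u t) (profile j₂ v t)

lemma blockTerm_eq_zero_of_not_interacts (h : ¬ Interacts j j₁ j₂) :
    blockTerm j j₁ j₂ u v = 0 := by
  funext τ
  simp [blockTerm, interaction_eq_zero h]

lemma enorm_blockTerm_le (hT : 0 < T) (ht : t ∈ Ico 0 T) :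
    ‖blockTerm j j₁ j₂ u v t‖ₑ ≤
      ENNReal.ofReal (4 * 2 ^ j * √(2 ^ min j (min j₁ j₂))) *
        (blockNorm T j₁ u * blockNorm T j₂ v) := by
  calc ‖blockTerm j j₁ j₂ u v t‖ₑ
      ≤ ENNReal.ofReal (4 * 2 ^ j * √(2 ^ min j (min j₁ j₂)) * ‖profile j₁ u t‖ *
          ‖profile j₂ v t‖) := by
        rw [← ofReal_norm]
        exact ENNReal.ofReal_le_ofReal (norm_interaction_le j j₁ j₂ t _ _)
    _ = ENNReal.ofReal (4 * 2 ^ j * √(2 ^ min j (min j₁ j₂))) *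
          (‖profile j₁ u t‖ₑ * ‖profile j₂ v t‖ₑ) := by
        rw [ENNReal.ofReal_mul (by positivity), ENNReal.ofReal_mul (by positivity), ofReal_norm,
          ofReal_norm, mul_assoc]
    _ ≤ _ := by
        gcongr
        · exact enorm_profile_le hT ht
        · exact enorm_profile_le hT ht

lemma blockTerm_eq_zero_or_blockNorm_ne_top (hT : 0 < T)
    (h : blockNorm T j₁ u * blockNorm T j₂ v ≠ ∞) :
    (∀ τ ∈ Ico 0 T, blockTerm j j₁ j₂ u v τ = 0) ∨
      (blockNorm T j₁ u ≠ ∞ ∧ blockNorm T j₂ v ≠ ∞) := by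
  by_cases h0 : blockNorm T j₁ u * blockNorm T j₂ v = 0
  · refine Or.inl fun τ hτ => ?_
    simpa [h0] using enorm_blockTerm_le (j := j) (j₁ := j₁) (j₂ := j₂) (u := u) (v := v) hT hτ
  · obtain ⟨hu, hv⟩ := mul_ne_zero_iff.1 h0
    exact Or.inr ⟨fun e => h (by rw [e, ENNReal.top_mul hv]),
      fun e => h (by rw [e, ENNReal.mul_top hu])⟩

lemma aestronglyMeasurable_blockTerm (hT : 0 < T)
    (h : blockNorm T j₁ u * blockNorm T j₂ v ≠ ∞) :
    AEStronglyMeasurable (blockTerm j j₁ j₂ u v) (volume.restrict (Ico 0 T)) := by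
  rcases blockTerm_eq_zero_or_blockNorm_ne_top (j := j) hT h with hzero | ⟨hu, hv⟩
  · refine (aestronglyMeasurable_zero (β := L2T)).congr ?_
    filter_upwards [ae_restrict_mem measurableSet_Ico] with τ hτ
    exact (hzero τ hτ).symm
  · exact aestronglyMeasurable_bilinear_apply (continuous_interaction j j₁ j₂)
      (aestronglyMeasurable_profile hT hu) (aestronglyMeasurable_profile hT hv)

lemma integrableOn_blockTerm (hT : 0 < T) (h : blockNorm T j₁ u * blockNorm T j₂ v ≠ ∞) :
    IntegrableOn (blockTerm j j₁ j₂ u v) (Ico 0 T) := by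
  refine ⟨aestronglyMeasurable_blockTerm hT h, ?_⟩
  rw [hasFiniteIntegral_iff_enorm]
  refine (setLIntegral_mono measurable_const fun τ hτ => enorm_blockTerm_le hT hτ).trans_lt ?_
  rw [setLIntegral_const]
  exact ENNReal.mul_lt_top (ENNReal.mul_lt_top ENNReal.ofReal_lt_top h.lt_top) (by simp)

lemma enorm_setIntegral_blockTerm_le (hT : 0 < T) {c d : ℝ} (hc : 0 ≤ c) (hd : d ≤ T) :
    ‖∫ τ in Ico c d, blockTerm j j₁ j₂ u v τ‖ₑ ≤
      ENNReal.ofReal (4 * 2 ^ j * √(2 ^ min j (min j₁ j₂)) * (d - c)) *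
        (blockNorm T j₁ u * blockNorm T j₂ v) := by
  calc _ ≤ ∫⁻ τ in Ico c d, ‖blockTerm j j₁ j₂ u v τ‖ₑ := enorm_integral_le_lintegral_enorm _
    _ ≤ ∫⁻ _ in Ico c d, ENNReal.ofReal (4 * 2 ^ j * √(2 ^ min j (min j₁ j₂))) *
        (blockNorm T j₁ u * blockNorm T j₂ v) :=
        setLIntegral_mono measurable_const fun τ hτ =>
          enorm_blockTerm_le hT (Ico_subset_Ico hc hd hτ)
    _ = _ := by
        rw [setLIntegral_const, Real.volume_Ico,
          ENNReal.ofReal_mul (p := 4 * 2 ^ j * √(2 ^ min j (min j₁ j₂))) (by positivity)]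
        ring

lemma enorm_setIntegral_blockTerm_le_of_le_window (hT : 0 < T) (hj : j ≠ 0) (hj₁ : j₁ ≠ 0)
    (hj₂ : j₂ ≠ 0) (h : blockNorm T j₁ u * blockNorm T j₂ v ≠ ∞) {c d : ℝ} (hc : 0 ≤ c)
    (hcd : c ≤ d) (hd : d ≤ T) (h₁ : d - c ≤ window T j₁) (h₂ : d - c ≤ window T j₂) :
    ‖∫ τ in Ico c d, blockTerm j j₁ j₂ u v τ‖ₑ ≤
      ENNReal.ofReal (8 * 2 ^ j / √(2 ^ max j (max j₁ j₂)) * √(d - c)) *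
        (blockNorm T j₁ u * blockNorm T j₂ v) := by
  rcases blockTerm_eq_zero_or_blockNorm_ne_top (j := j) hT h with hzero | ⟨hu, hv⟩
  · rw [setIntegral_congr_fun (g := fun _ => (0 : L2T)) measurableSet_Ico
      fun τ hτ => hzero τ (Ico_subset_Ico hc hd hτ)]
    simp
  · obtain ⟨a₁, ha₁, hb₁, hsub₁⟩ := exists_window_superset hc hd h₁
    obtain ⟨a₂, ha₂, hb₂, hsub₂⟩ := exists_window_superset hc hd h₂
    have hle₁ := U2norm_le_blockNorm (u := u) ha₁ hb₁
    have hle₂ := U2norm_le_blockNorm (u := v) ha₂ hb₂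
    refine (enorm_integral_bilinear_le_mul_U2norm (continuous_interaction j j₁ j₂) (by positivity)
      (fun x y c d hcd => norm_setIntegral_interaction_le hj hj₁ hj₂ x y hcd) hcd hsub₁ hsub₂
      (ne_top_of_le_ne_top hu hle₁) (ne_top_of_le_ne_top hv hle₂)).trans ?_
    rw [mul_assoc]
    gcongr

end Block

/-! ### Bounds on dyadic time scales -/

section LevelBounds

variable {j j₁ j₂ : ℕ}

lemma tsum_le_of_geometric_of_bounded_of_geometric {g : ℕ → ℝ≥0∞} {C r : ℝ≥0∞} {m l : ℕ}
    (hhead : ∀ n < m, g n ≤ C * r ^ n) (hmiddle : ∀ i < l, g (m + i) ≤ C)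
    (htail : ∀ i, g (m + l + i) ≤ C * r ^ i) :
    ∑' n, g n ≤ 2 * C * (1 - r)⁻¹ * (1 + l) := by
  have hone : 1 ≤ (1 - r)⁻¹ := ENNReal.one_le_inv.2 tsub_le_self
  have hgeom : ∑' n, C * r ^ n = C * (1 - r)⁻¹ := by
    rw [ENNReal.tsum_mul_left, ENNReal.tsum_geometric]
  calc ∑' n, g n = ∑ n ∈ Finset.range m, g n + ∑ i ∈ Finset.range l, g (m + i) +
        ∑' i, g (m + l + i) := by
        rw [← Finset.sum_range_add, ← ENNReal.summable.sum_add_tsum_nat_add' (k := m + l)]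
        simp only [add_comm]
    _ ≤ C * (1 - r)⁻¹ + l * C + C * (1 - r)⁻¹ := by
        gcongr
        · rw [← hgeom]
          exact (Finset.sum_le_sum fun n hn => hhead n (Finset.mem_range.1 hn)).trans
            (ENNReal.sum_le_tsum _)
        · simpa using Finset.sum_le_card_nsmul (Finset.range l) (fun i => g (m + i)) C
            fun i hi => hmiddle i (Finset.mem_range.1 hi)
        · exact (ENNReal.tsum_le_tsum htail).trans_eq hgeom
    _ ≤ C * (1 - r)⁻¹ + (l * (C * (1 - r)⁻¹) + l * (C * (1 - r)⁻¹)) + C * (1 - r)⁻¹ := by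
        gcongr
        exact le_add_right (by gcongr; exact le_mul_of_one_le_right' hone)
    _ = 2 * C * (1 - r)⁻¹ * (1 + l) := by ring

/-- The sum of the geometric series with ratio `1 / √2`. -/
def geomConst : ℝ≥0∞ := (1 - ENNReal.ofReal (√2)⁻¹)⁻¹

lemma geomConst_ne_top : geomConst ≠ ∞ := by
  refine ENNReal.inv_ne_top.2 (tsub_pos_of_lt (ENNReal.ofReal_lt_one.2 ?_)).ne'
  exact inv_lt_one_of_one_lt₀ (Real.lt_sqrt_of_sq_lt (by norm_num))

lemma geomConst_ne_zero : geomConst ≠ 0 :=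
  ENNReal.inv_ne_zero.2 (ENNReal.sub_ne_top ENNReal.one_ne_top)

/-- The sum over all dyadic time scales of the interaction of the blocks at the frequencies
`2 ^ j`, `2 ^ j₁`, `2 ^ j₂`, up to an absolute constant: it is logarithmic in the smallest of the
three frequencies. -/
def interactionWeight (j j₁ j₂ : ℕ) : ℝ≥0∞ :=
  if Interacts j j₁ j₂ then 1 + (min j (min j₁ j₂) : ℕ) else 0

lemma one_le_interactionWeight (h : Interacts j j₁ j₂) : 1 ≤ interactionWeight j j₁ j₂ := by
  rw [interactionWeight, if_pos h]
  exact le_self_add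

lemma ne_top_of_interactionWeight_mul_ne_top {x : ℝ≥0∞} (h : Interacts j j₁ j₂)
    (hx : interactionWeight j j₁ j₂ * x ≠ ∞) : x ≠ ∞ :=
  ne_top_of_le_ne_top hx (le_mul_of_one_le_left' (one_le_interactionWeight h))

/-- The bound, relative to the norms of the two factors, for the time integrals of `blockTerm` over
the dyadic subintervals of level `n` of a window. On the intervals longer than the windows of the
highest frequency the oscillation is used in each of those windows, on the intermediate intervals
it is used once, and on the shortest ones the integrand is estimated pointwise. -/
def levelBound (j j₁ j₂ n : ℕ) : ℝ≥0∞ :=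
  if ¬ Interacts j j₁ j₂ then 0
  else if n < max j (max j₁ j₂) - j then ENNReal.ofReal (8 / 2 ^ n)
  else if n < max j (max j₁ j₂) - j + min j (min j₁ j₂) then ENNReal.ofReal (8 / √(2 ^ n))
  else ENNReal.ofReal (4 * √(2 ^ min j (min j₁ j₂)) / 2 ^ n)

lemma inv_sqrt_two_pow (n : ℕ) : (√((2 : ℝ) ^ n))⁻¹ = (√2)⁻¹ ^ n := by
  rw [inv_pow, inv_inj, Real.sqrt_eq_iff_eq_sq (by positivity) (by positivity), ← pow_mul,
    mul_comm, pow_mul, Real.sq_sqrt two_pos.le]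

lemma sqrt_two_pow_mul_div_two_pow (n : ℕ) (x : ℝ) : √(2 ^ n) * (x / 2 ^ n) = x * (√2)⁻¹ ^ n := by
  rw [← inv_sqrt_two_pow, ← Real.sqrt_div_self]
  ring

lemma sqrt_mul_fineBound_le (m l i : ℕ) :
    √(2 ^ (m + l + i)) * (4 * √(2 ^ l) / 2 ^ (m + l + i)) ≤ 8 * (√2)⁻¹ ^ i := by
  have hr : (√2)⁻¹ ≤ 1 := inv_le_one_of_one_le₀ (Real.one_le_sqrt.2 one_le_two)
  calc _ = 4 * (√(2 ^ l) * (√(2 ^ l))⁻¹) * (√2)⁻¹ ^ m * (√2)⁻¹ ^ i := by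
        rw [sqrt_two_pow_mul_div_two_pow, inv_sqrt_two_pow]
        ring
    _ ≤ 4 * 1 * 1 * (√2)⁻¹ ^ i := by
        gcongr
        · exact mul_inv_le_one
        · exact pow_le_one₀ (by positivity) hr
    _ ≤ 8 * (√2)⁻¹ ^ i := by
        gcongr
        norm_num

lemma tsum_sqrt_mul_levelBound_le (j j₁ j₂ : ℕ) :
    ∑' n, ENNReal.ofReal √(2 ^ n) * levelBound j j₁ j₂ n ≤
      16 * geomConst * interactionWeight j j₁ j₂ := by
  by_cases h : Interacts j j₁ j₂
  swap
  · simp [levelBound, h]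
  have hgeom (n : ℕ) : ENNReal.ofReal (8 * (√2)⁻¹ ^ n) = 8 * ENNReal.ofReal (√2)⁻¹ ^ n := by
    rw [ENNReal.ofReal_mul (by norm_num), ENNReal.ofReal_pow (by positivity), ENNReal.ofReal_ofNat]
  rw [interactionWeight, if_pos h]
  simp only [levelBound, h, not_true_eq_false, if_false]
  refine (tsum_le_of_geometric_of_bounded_of_geometric (C := 8) (r := ENNReal.ofReal (√2)⁻¹)
    (m := max j (max j₁ j₂) - j) (l := min j (min j₁ j₂)) (fun n hn => ?_) (fun i hi => ?_)
    fun i => ?_).trans_eq ?_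
  · rw [if_pos hn, ← ENNReal.ofReal_mul (by positivity), sqrt_two_pow_mul_div_two_pow, hgeom]
  · rw [if_neg (by lia), if_pos (by lia), ← ENNReal.ofReal_mul (by positivity),
      mul_div_cancel₀ _ (by positivity), ENNReal.ofReal_ofNat]
  · rw [if_neg (by lia), if_neg (by lia), ← ENNReal.ofReal_mul (by positivity), ← hgeom]
    exact ENNReal.ofReal_le_ofReal (sqrt_mul_fineBound_le _ _ i)
  · rw [geomConst]
    ring

end LevelBounds

section GridBounds

variable {T a : ℝ} {j j₁ j₂ n i : ℕ} {u v : ℝ → L2T}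

lemma exists_gridCell_eq_Ico (hT : 0 < T) (ha : 0 ≤ a) (hb : a + window T j ≤ T)
    (hi : i < 2 ^ n) :
    ∃ c d, gridCell a (a + window T j) n i = Ico c d ∧ 0 ≤ c ∧ c ≤ d ∧ d ≤ T ∧
      d - c = window T j / 2 ^ n := by
  have hab : a < a + window T j := by linarith [window_pos hT j]
  refine ⟨_, _, rfl, ha.trans (grid_mem_Icc hab hi.le).1,
    ((strictMono_grid hab n).monotone i.le_succ), (grid_mem_Icc hab hi).2.trans hb, ?_⟩
  rw [grid_succ_sub_grid, add_sub_cancel_left]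

lemma enorm_setIntegral_gridCell_blockTerm_le_of_fine (hT : 0 < T) (ha : 0 ≤ a)
    (hb : a + window T j ≤ T) (hi : i < 2 ^ n) :
    ‖∫ τ in gridCell a (a + window T j) n i, blockTerm j j₁ j₂ u v τ‖ₑ ≤
      ENNReal.ofReal (4 * √(2 ^ min j (min j₁ j₂)) / 2 ^ n) *
        (blockNorm T j₁ u * blockNorm T j₂ v) := by
  obtain ⟨c, d, hcell, hc, -, hd, hlength⟩ := exists_gridCell_eq_Ico hT ha hb hi
  rw [hcell]
  refine (enorm_setIntegral_blockTerm_le hT hc hd).trans ?_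
  gcongr
  calc 4 * 2 ^ j * √(2 ^ min j (min j₁ j₂)) * (d - c)
      ≤ 4 * 2 ^ j * √(2 ^ min j (min j₁ j₂)) * ((2 ^ j)⁻¹ / 2 ^ n) := by
        rw [hlength]
        gcongr
        exact window_le_inv_two_pow T j
    _ = 4 * √(2 ^ min j (min j₁ j₂)) / 2 ^ n := by field_simp

lemma window_div_two_pow_le_window (hT : 0 < T) {k : ℕ} (hk : k ≤ j + n) :
    window T j / 2 ^ n ≤ window T k := by
  refine le_min ?_ ?_
  · calc window T j / 2 ^ n ≤ (2 ^ j)⁻¹ / 2 ^ n := by gcongr; exact window_le_inv_two_pow T j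
      _ = (2 ^ (j + n))⁻¹ := by rw [pow_add]; field_simp
      _ ≤ (2 ^ k)⁻¹ := by gcongr; exact one_le_two
  · exact (div_le_self (window_pos hT j).le (one_le_pow₀ one_le_two)).trans (window_le T j)

lemma enorm_setIntegral_gridCell_blockTerm_le_of_medium (hT : 0 < T) (hj : j ≠ 0)
    (hj₁ : j₁ ≠ 0) (hj₂ : j₂ ≠ 0) (h : blockNorm T j₁ u * blockNorm T j₂ v ≠ ∞) (ha : 0 ≤ a)
    (hb : a + window T j ≤ T) (hi : i < 2 ^ n) {m : ℕ} (hm : j + m = max j (max j₁ j₂))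
    (hmn : m ≤ n) :
    ‖∫ τ in gridCell a (a + window T j) n i, blockTerm j j₁ j₂ u v τ‖ₑ ≤
      ENNReal.ofReal (8 / (√(2 ^ m) * √(2 ^ n))) * (blockNorm T j₁ u * blockNorm T j₂ v) := by
  obtain ⟨c, d, hcell, hc, hcd, hd, hlength⟩ := exists_gridCell_eq_Ico hT ha hb hi
  rw [hcell]
  refine (enorm_setIntegral_blockTerm_le_of_le_window hT hj hj₁ hj₂ h hc hcd hd
    (hlength.trans_le (window_div_two_pow_le_window hT (by lia)))
    (hlength.trans_le (window_div_two_pow_le_window hT (by lia)))).trans ?_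
  gcongr
  calc 8 * 2 ^ j / √(2 ^ max j (max j₁ j₂)) * √(d - c)
      ≤ 8 * 2 ^ j / √(2 ^ (j + m)) * √((2 ^ j)⁻¹ / 2 ^ n) := by
        rw [hlength, hm]
        gcongr
        exact window_le_inv_two_pow T j
    _ = 8 * (√(2 ^ j) * √(2 ^ j)) / (√(2 ^ j) * √(2 ^ m)) * ((√(2 ^ j))⁻¹ / √(2 ^ n)) := by
        rw [pow_add, Real.sqrt_mul (by positivity), Real.sqrt_div (by positivity), Real.sqrt_inv,
          Real.mul_self_sqrt (by positivity)]
    _ = 8 / (√(2 ^ m) * √(2 ^ n)) := by field_simp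

lemma enorm_setIntegral_gridCell_blockTerm_le_of_coarse (hT : 0 < T) (hj : j ≠ 0)
    (hj₁ : j₁ ≠ 0) (hj₂ : j₂ ≠ 0) (h : blockNorm T j₁ u * blockNorm T j₂ v ≠ ∞) (ha : 0 ≤ a)
    (hb : a + window T j ≤ T) (hi : i < 2 ^ n) {r : ℕ} (hr : j + (n + r) = max j (max j₁ j₂)) :
    ‖∫ τ in gridCell a (a + window T j) n i, blockTerm j j₁ j₂ u v τ‖ₑ ≤
      ENNReal.ofReal (8 / 2 ^ n) * (blockNorm T j₁ u * blockNorm T j₂ v) := by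
  have hab : a < a + window T j := by linarith [window_pos hT j]
  calc _ ≤ 2 ^ r * (ENNReal.ofReal (8 / (√(2 ^ (n + r)) * √(2 ^ (n + r)))) *
        (blockNorm T j₁ u * blockNorm T j₂ v)) :=
        enorm_setIntegral_gridCell_le_two_pow_mul hab
          ((integrableOn_blockTerm hT h).mono_set (Ico_subset_Ico ha hb))
          (fun _ hi' => enorm_setIntegral_gridCell_blockTerm_le_of_medium hT hj hj₁ hj₂ h ha hb
            hi' hr le_rfl) hi
    _ = ENNReal.ofReal (2 ^ r * (8 / (2 ^ n * 2 ^ r))) *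
        (blockNorm T j₁ u * blockNorm T j₂ v) := by
        rw [Real.mul_self_sqrt (by positivity), ENNReal.ofReal_mul (by positivity),
          ENNReal.ofReal_pow two_pos.le, ENNReal.ofReal_ofNat, pow_add, mul_assoc]
    _ = _ := by
        congr 2
        field_simp

lemma enorm_setIntegral_gridCell_blockTerm_le (hT : 0 < T)
    (h : interactionWeight j j₁ j₂ * (blockNorm T j₁ u * blockNorm T j₂ v) ≠ ∞) (ha : 0 ≤ a)
    (hb : a + window T j ≤ T) (hi : i < 2 ^ n) :
    ‖∫ τ in gridCell a (a + window T j) n i, blockTerm j j₁ j₂ u v τ‖ₑ ≤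
      levelBound j j₁ j₂ n * (blockNorm T j₁ u * blockNorm T j₂ v) := by
  by_cases hinter : Interacts j j₁ j₂
  swap
  · simp [blockTerm_eq_zero_of_not_interacts hinter]
  have hfin := ne_top_of_interactionWeight_mul_ne_top hinter h
  have hfine := enorm_setIntegral_gridCell_blockTerm_le_of_fine (j₁ := j₁) (j₂ := j₂) (u := u)
    (v := v) hT ha hb hi
  simp only [levelBound, hinter, not_true_eq_false, if_false]
  by_cases h0 : min j (min j₁ j₂) = 0
  · refine hfine.trans ?_
    rw [h0, pow_zero, Real.sqrt_one, mul_one, add_zero]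
    gcongr
    split_ifs
    · gcongr
      norm_num
    · exact le_rfl
  have hj : j ≠ 0 := by lia
  have hj₁ : j₁ ≠ 0 := by lia
  have hj₂ : j₂ ≠ 0 := by lia
  split_ifs with hcoarse hmedium
  · exact enorm_setIntegral_gridCell_blockTerm_le_of_coarse hT hj hj₁ hj₂ hfin ha hb hi
      (r := max j (max j₁ j₂) - j - n) (by lia)
  · refine (enorm_setIntegral_gridCell_blockTerm_le_of_medium hT hj hj₁ hj₂ hfin ha hb hi
      (m := max j (max j₁ j₂) - j) (by lia) (by lia)).trans ?_
    gcongr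
    exact le_mul_of_one_le_left (Real.sqrt_nonneg _) (Real.one_le_sqrt.2 (one_le_pow₀ one_le_two))
  · exact hfine

end GridBounds

section DyadicEstimate

lemma integrable_of_hasSum {α ι E : Type*} [MeasurableSpace α] [NormedAddCommGroup E]
    [Countable ι] {μ : Measure α} {h : ι → α → E} {f : α → E}
    (hh : ∀ i, AEStronglyMeasurable (h i) μ) (hfin : ∑' i, ∫⁻ x, ‖h i x‖ₑ ∂μ ≠ ∞)
    (hsum : ∀ᵐ x ∂μ, HasSum (h · x) (f x)) : Integrable f μ := by
  refine ⟨aestronglyMeasurable_of_tendsto_ae (u := (atTop : Filter (Finset ι)))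
    (f := fun s x => ∑ i ∈ s, h i x)
    (fun s => Finset.aestronglyMeasurable_fun_sum s fun i _ => hh i) hsum, ?_⟩
  rw [hasFiniteIntegral_iff_enorm]
  calc ∫⁻ x, ‖f x‖ₑ ∂μ ≤ ∫⁻ x, ∑' i, ‖h i x‖ₑ ∂μ := by
        refine lintegral_mono_ae ?_
        filter_upwards [hsum] with x hx
        rw [← hx.tsum_eq]
        exact enorm_tsum_le_tsum_enorm
    _ = ∑' i, ∫⁻ x, ‖h i x‖ₑ ∂μ := lintegral_tsum fun i => (hh i).enorm
    _ < ∞ := hfin.lt_top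

lemma enorm_integral_le_tsum_of_hasSum {α ι E : Type*} [MeasurableSpace α]
    [NormedAddCommGroup E] [NormedSpace ℝ E] [Countable ι] {μ : Measure α} {h : ι → α → E}
    {f : α → E} (hh : ∀ i, AEStronglyMeasurable (h i) μ)
    (hfin : ∑' i, ∫⁻ x, ‖h i x‖ₑ ∂μ ≠ ∞) (hsum : ∀ᵐ x ∂μ, HasSum (h · x) (f x)) :
    ‖∫ x, f x ∂μ‖ₑ ≤ ∑' i, ‖∫ x, h i x ∂μ‖ₑ := by
  rw [integral_congr_ae (hsum.mono fun x hx => hx.tsum_eq.symm), integral_tsum hh hfin]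
  exact enorm_tsum_le_tsum_enorm

variable {T a : ℝ} {j j₁ j₂ : ℕ} {u v : ℝ → L2T}

lemma aestronglyMeasurable_blockTerm_of_interactionWeight_mul_ne_top (hT : 0 < T)
    (h : interactionWeight j j₁ j₂ * (blockNorm T j₁ u * blockNorm T j₂ v) ≠ ∞) :
    AEStronglyMeasurable (blockTerm j j₁ j₂ u v) (volume.restrict (Ico 0 T)) := by
  by_cases hinter : Interacts j j₁ j₂
  · exact aestronglyMeasurable_blockTerm hT (ne_top_of_interactionWeight_mul_ne_top hinter h)
  · rw [blockTerm_eq_zero_of_not_interacts hinter]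
    exact aestronglyMeasurable_zero

lemma enorm_blockTerm_le_interactionWeight_mul (hT : 0 < T) {t : ℝ} (ht : t ∈ Ico 0 T) :
    ‖blockTerm j j₁ j₂ u v t‖ₑ ≤ ENNReal.ofReal (4 * 2 ^ j * √(2 ^ j)) *
      (interactionWeight j j₁ j₂ * (blockNorm T j₁ u * blockNorm T j₂ v)) := by
  by_cases hinter : Interacts j j₁ j₂
  · refine (enorm_blockTerm_le hT ht).trans ?_
    gcongr ENNReal.ofReal (4 * 2 ^ j * √(2 ^ ?_)) * ?_
    · exact one_le_two
    · exact min_le_left _ _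
    · exact le_mul_of_one_le_left' (one_le_interactionWeight hinter)
  · simp [blockTerm_eq_zero_of_not_interacts hinter]

lemma tsum_lintegral_enorm_blockTerm_ne_top (hT : 0 < T)
    (h : ∑' q : ℕ × ℕ, interactionWeight j q.1 q.2 *
      (blockNorm T q.1 u * blockNorm T q.2 v) ≠ ∞) :
    ∑' q : ℕ × ℕ, ∫⁻ t in Ico 0 T, ‖blockTerm j q.1 q.2 u v t‖ₑ ≠ ∞ := by
  refine ne_top_of_le_ne_top ?_ (ENNReal.tsum_le_tsum fun q => setLIntegral_mono
    measurable_const fun t ht => enorm_blockTerm_le_interactionWeight_mul hT ht)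
  simp_rw [setLIntegral_const, ENNReal.tsum_mul_right, ENNReal.tsum_mul_left]
  exact ENNReal.mul_ne_top (ENNReal.mul_ne_top ENNReal.ofReal_ne_top h) (by simp)

lemma nontrivial_L2T : Nontrivial L2T :=
  ⟨fourierLp 2 0, 0, fun h => by
    simpa [h] using (orthonormal_fourier (T := 2 * Real.pi)).1 0⟩

lemma DU2norm_dxMul_le (hT : 0 < T) (ha : 0 ≤ a) (hb : a + window T j ≤ T) :
    DU2norm a (a + window T j) (fun t => flow (-t) (dyadicProj j (dxMul u v t))) ≤
      16 * geomConst * ∑' q : ℕ × ℕ, interactionWeight j q.1 q.2 *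
        (blockNorm T q.1 u * blockNorm T q.2 v) := by
  by_cases hfin : ∑' q : ℕ × ℕ, interactionWeight j q.1 q.2 *
      (blockNorm T q.1 u * blockNorm T q.2 v) = ∞
  · simp [hfin, ENNReal.mul_top, geomConst_ne_zero]
  have hab : a < a + window T j := by linarith [window_pos hT j]
  have hq (q : ℕ × ℕ) := ENNReal.ne_top_of_tsum_ne_top hfin q
  have hmeas (q : ℕ × ℕ) := aestronglyMeasurable_blockTerm_of_interactionWeight_mul_ne_top hT (hq q)
  have hlintegral := tsum_lintegral_enorm_blockTerm_ne_top hT hfin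
  have hsum (t : ℝ) : HasSum (fun q : ℕ × ℕ => blockTerm j q.1 q.2 u v t)
      (flow (-t) (dyadicProj j (dxMul u v t))) := hasSum_interaction_profile j u v t
  have hint : IntegrableOn (fun t => flow (-t) (dyadicProj j (dxMul u v t))) (Ico 0 T) :=
    integrable_of_hasSum hmeas hlintegral (.of_forall hsum)
  have hcell (n i : ℕ) (hi : i < 2 ^ n) :
      ‖∫ t in gridCell a (a + window T j) n i, flow (-t) (dyadicProj j (dxMul u v t))‖ₑ ≤
        ∑' q : ℕ × ℕ, levelBound j q.1 q.2 n * (blockNorm T q.1 u * blockNorm T q.2 v) := by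
    have hsub := (gridCell_subset hab hi).trans (Ico_subset_Ico ha hb)
    refine (enorm_integral_le_tsum_of_hasSum (fun q => (hmeas q).mono_set hsub)
      (ne_top_of_le_ne_top hlintegral (ENNReal.tsum_le_tsum fun q => lintegral_mono_set hsub))
      (.of_forall hsum)).trans ?_
    exact ENNReal.tsum_le_tsum fun q =>
      enorm_setIntegral_gridCell_blockTerm_le hT (hq q) ha hb hi
  have := nontrivial_L2T
  refine (DU2norm_le_tsum_of_dyadic_integrals hab ?_ hcell).trans ?_
  · rw [intervalIntegrable_iff_integrableOn_Ico_of_le hab.le]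
    exact hint.mono_set (Ico_subset_Ico ha hb)
  · simp_rw [← ENNReal.tsum_mul_left]
    rw [ENNReal.tsum_comm]
    refine ENNReal.tsum_le_tsum fun q => ?_
    simp_rw [← mul_assoc, ENNReal.tsum_mul_right]
    gcongr
    exact tsum_sqrt_mul_levelBound_le j q.1 q.2

end DyadicEstimate

/-! ### Summation over the dyadic frequencies -/

section Summation

lemma sq_tsum_mul_le {ι : Type*} (w f : ι → ℝ≥0∞) :
    (∑' i, w i * f i) ^ 2 ≤ (∑' i, w i) * ∑' i, w i * f i ^ 2 := by
  have hsqrt : ∑' i, w i * f i ≤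
      (∑' i, w i) ^ (1 / 2 : ℝ) * (∑' i, w i * f i ^ 2) ^ (1 / 2 : ℝ) := by
    rw [ENNReal.tsum_eq_iSup_sum]
    refine iSup_le fun s => ?_
    calc ∑ i ∈ s, w i * f i ≤ (∑ i ∈ s, w i) ^ (1 / 2 : ℝ) *
          (∑ i ∈ s, w i * f i ^ 2) ^ (1 / 2 : ℝ) := by
          have := ENNReal.inner_le_weight_mul_Lp_of_nonneg s one_le_two w f
          norm_num at this ⊢
          exact this
      _ ≤ _ := by
          gcongr <;> exact ENNReal.sum_le_tsum s
  calc (∑' i, w i * f i) ^ 2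
      ≤ ((∑' i, w i) ^ (1 / 2 : ℝ) * (∑' i, w i * f i ^ 2) ^ (1 / 2 : ℝ)) ^ 2 := by gcongr
    _ = _ := by
        rw [mul_pow, ← ENNReal.rpow_mul_natCast, ← ENNReal.rpow_mul_natCast]
        norm_num

lemma ennreal_add_sq_le (x y : ℝ≥0∞) : (x + y) ^ 2 ≤ 2 * (x ^ 2 + y ^ 2) := by
  have := ENNReal.rpow_add_le_mul_rpow_add_rpow x y one_le_two
  norm_num at this
  exact this

lemma tsum_sq_tsum_mul_le_of_schur {ι κ : Type*} {k : ι → κ → ℝ≥0∞} {A B : ℝ≥0∞}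
    (hrow : ∀ i, ∑' l, k i l ≤ A) (hcol : ∀ l, ∑' i, k i l ≤ B) (f : κ → ℝ≥0∞) :
    ∑' i, (∑' l, k i l * f l) ^ 2 ≤ A * B * ∑' l, f l ^ 2 := by
  calc ∑' i, (∑' l, k i l * f l) ^ 2 ≤ ∑' i, A * ∑' l, k i l * f l ^ 2 := by
        gcongr with i
        exact (sq_tsum_mul_le _ _).trans (by gcongr; exact hrow i)
    _ = A * ∑' l, (∑' i, k i l) * f l ^ 2 := by
        rw [ENNReal.tsum_mul_left, ENNReal.tsum_comm]
        simp_rw [ENNReal.tsum_mul_right]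
    _ ≤ A * ∑' l, B * f l ^ 2 := by
        gcongr with l
        exact hcol l
    _ = A * B * ∑' l, f l ^ 2 := by rw [ENNReal.tsum_mul_left, mul_assoc]

lemma tsum_pow_dist_le (q : ℝ≥0∞) (j : ℕ) : ∑' l, q ^ Nat.dist j l ≤ 2 * ∑' n, q ^ n := by
  rw [← ENNReal.summable.sum_add_tsum_nat_add' (k := j), two_mul]
  refine add_le_add ?_ (ENNReal.tsum_le_tsum fun n => ?_)
  · rw [← Finset.sum_range_reflect]
    calc _ = ∑ i ∈ Finset.range j, q ^ (i + 1) := by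
          refine Finset.sum_congr rfl fun i hi => ?_
          rw [Finset.mem_range] at hi
          rw [Nat.dist]
          congr 1
          lia
      _ ≤ ∑' i, q ^ (i + 1) := ENNReal.sum_le_tsum _
      _ ≤ _ := ENNReal.tsum_comp_le_tsum_of_injective (add_left_injective 1) fun n => q ^ n
  · rw [Nat.dist_eq_sub_of_le (Nat.le_add_left j n), Nat.add_sub_cancel]

lemma sq_tsum_pow_mul_le {q : ℝ≥0∞} (hq : q ≤ 1) (f : ℕ → ℝ≥0∞) :
    (∑' n, q ^ n * f n) ^ 2 ≤ (∑' n, q ^ n) * ∑' n, f n ^ 2 := by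
  refine (sq_tsum_mul_le _ _).trans ?_
  gcongr with n
  exact mul_le_of_le_one_left' (pow_le_one' hq n)

lemma tsum_sq_tsum_pow_dist_mul_le (q : ℝ≥0∞) (f : ℕ → ℝ≥0∞) :
    ∑' j, (∑' l, q ^ Nat.dist j l * f l) ^ 2 ≤
      2 * (∑' n, q ^ n) * (2 * ∑' n, q ^ n) * ∑' l, f l ^ 2 :=
  tsum_sq_tsum_mul_le_of_schur (tsum_pow_dist_le q)
    (fun l => by simpa only [Nat.dist_comm] using tsum_pow_dist_le q l) f

/-- A kernel that decays geometrically in one of the two input frequencies and in the distance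
between the other one and the output frequency. -/
def dyadicKernel (q : ℝ≥0∞) (j j₁ j₂ : ℕ) : ℝ≥0∞ :=
  q ^ j₁ * q ^ Nat.dist j j₂ + q ^ j₂ * q ^ Nat.dist j j₁

lemma tsum_dyadicKernel_mul (q : ℝ≥0∞) (j : ℕ) (f g : ℕ → ℝ≥0∞) :
    ∑' p : ℕ × ℕ, dyadicKernel q j p.1 p.2 * (f p.1 * g p.2) =
      (∑' n, q ^ n * f n) * (∑' l, q ^ Nat.dist j l * g l) +
      (∑' n, q ^ n * g n) * (∑' l, q ^ Nat.dist j l * f l) := by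
  rw [mul_comm (∑' n, q ^ n * g n), ← ENNReal.tsum_mul_right, ← ENNReal.tsum_mul_right,
    ← ENNReal.tsum_add, ENNReal.tsum_prod']
  refine tsum_congr fun i => ?_
  rw [← ENNReal.tsum_mul_left, ← ENNReal.tsum_mul_left, ← ENNReal.tsum_add]
  refine tsum_congr fun l => ?_
  rw [dyadicKernel]
  ring

lemma tsum_sq_tsum_dyadicKernel_mul_le {q : ℝ≥0∞} (hq : q ≤ 1) (f g : ℕ → ℝ≥0∞) :
    ∑' j, (∑' p : ℕ × ℕ, dyadicKernel q j p.1 p.2 * (f p.1 * g p.2)) ^ 2 ≤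
      16 * (∑' n, q ^ n) ^ 3 * ((∑' n, f n ^ 2) * ∑' n, g n ^ 2) := by
  set Q := ∑' n, q ^ n
  calc _ ≤ ∑' j, 2 * (
        (∑' n, q ^ n * f n) ^ 2 * (∑' l, q ^ Nat.dist j l * g l) ^ 2 +
        (∑' n, q ^ n * g n) ^ 2 * (∑' l, q ^ Nat.dist j l * f l) ^ 2) := by
        gcongr with j
        rw [tsum_dyadicKernel_mul, ← mul_pow, ← mul_pow]
        exact ennreal_add_sq_le _ _
    _ = 2 * ((∑' n, q ^ n * f n) ^ 2 * ∑' j, (∑' l, q ^ Nat.dist j l * g l) ^ 2 +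
        (∑' n, q ^ n * g n) ^ 2 * ∑' j, (∑' l, q ^ Nat.dist j l * f l) ^ 2) := by
        rw [ENNReal.tsum_mul_left, ENNReal.tsum_add, ENNReal.tsum_mul_left, ENNReal.tsum_mul_left]
    _ ≤ 2 * ((Q * ∑' n, f n ^ 2) * (2 * Q * (2 * Q) * ∑' n, g n ^ 2) +
        (Q * ∑' n, g n ^ 2) * (2 * Q * (2 * Q) * ∑' n, f n ^ 2)) := by
        gcongr
        · exact sq_tsum_pow_mul_le hq f
        · exact tsum_sq_tsum_pow_dist_mul_le q g
        · exact sq_tsum_pow_mul_le hq g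
        · exact tsum_sq_tsum_pow_dist_mul_le q f
    _ = 16 * Q ^ 3 * ((∑' n, f n ^ 2) * ∑' n, g n ^ 2) := by ring

end Summation

section Decay

/-- The ratio of the geometric decay left after the weights `N ^ s` have absorbed the logarithmic
loss in `interactionWeight`. -/
def decayRatio (s : ℝ) : ℝ≥0∞ := 2 ^ (-(s / 4))

lemma decayRatio_lt_one {s : ℝ} (hs : 0 < s) : decayRatio s < 1 :=
  ENNReal.rpow_lt_one_of_one_lt_of_neg (by norm_num) (by linarith)

lemma decayRatio_pow (s : ℝ) (n : ℕ) : decayRatio s ^ n = 2 ^ (-(s / 4) * n) := by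
  rw [decayRatio, ENNReal.rpow_mul_natCast]

/-- The constant in the bound for `interactionWeight` by `dyadicKernel`. -/
def decayConst (s : ℝ) : ℝ≥0∞ :=
  ENNReal.ofReal (2 ^ (s / 2) / (2 ^ (s / 2) - 1)) * 2 ^ (s + s / 4)

lemma decayConst_ne_top (s : ℝ) : decayConst s ≠ ∞ :=
  ENNReal.mul_ne_top ENNReal.ofReal_ne_top (by finiteness)

lemma one_add_le_div_mul_pow {x : ℝ} (hx : 1 < x) (n : ℕ) : 1 + n ≤ x / (x - 1) * x ^ n := by
  have hbernoulli : 1 + n * (x - 1) ≤ x ^ n := by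
    simpa using one_add_mul_le_pow (a := x - 1) (by linarith) n
  have hx' : 0 < x - 1 := sub_pos.2 hx
  rw [div_mul_eq_mul_div, le_div_iff₀ hx']
  nlinarith [mul_le_mul_of_nonneg_left hbernoulli (zero_le_one.trans hx.le),
    mul_nonneg n.cast_nonneg (sq_nonneg (x - 1))]

lemma one_add_le_mul_two_rpow {r : ℝ} (hr : 0 < r) (n : ℕ) :
    (1 + n : ℝ≥0∞) ≤ ENNReal.ofReal (2 ^ r / (2 ^ r - 1)) * 2 ^ (r * n) := by
  calc (1 + n : ℝ≥0∞) = ENNReal.ofReal (1 + n) := by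
        rw [ENNReal.ofReal_add zero_le_one n.cast_nonneg, ENNReal.ofReal_one,
          ENNReal.ofReal_natCast]
    _ ≤ ENNReal.ofReal (2 ^ r / (2 ^ r - 1) * (2 ^ r) ^ n) :=
        ENNReal.ofReal_le_ofReal
          (one_add_le_div_mul_pow (Real.one_lt_rpow one_lt_two hr) n)
    _ = ENNReal.ofReal (2 ^ r / (2 ^ r - 1)) * 2 ^ (r * n) := by
        rw [ENNReal.ofReal_mul' (by positivity), ENNReal.ofReal_pow (by positivity),
          ← ENNReal.ofReal_rpow_of_pos two_pos, ENNReal.ofReal_ofNat, ENNReal.rpow_mul_natCast]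

lemma two_rpow_add (x y : ℝ) : (2 : ℝ≥0∞) ^ (x + y) = 2 ^ x * 2 ^ y :=
  ENNReal.rpow_add x y two_ne_zero ENNReal.ofNat_ne_top

variable {s σ : ℝ} {j j₁ j₂ : ℕ}

lemma two_rpow_mul_one_add_le (hs : 0 < s) (hσ : 0 ≤ σ) (hσs : σ ≤ s) {m M : ℕ} (hj : j ≤ M + 1)
    (hM : M ≤ max j m + 1) :
    (2 : ℝ≥0∞) ^ (σ * j) * (1 + m) ≤
      decayConst s * (decayRatio s ^ m * decayRatio s ^ Nat.dist j M) *
        (2 ^ (σ * M) * 2 ^ (s * m)) := by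
  have hdist : Nat.dist j M ≤ m + 1 := by
    rw [Nat.dist]
    lia
  have hexponent : σ * j + s / 2 * m ≤
      s + s / 4 + (-(s / 4) * m + -(s / 4) * Nat.dist j M) + (σ * M + s * m) := by
    have hj' : (j : ℝ) ≤ M + 1 := by exact_mod_cast hj
    have hdist' : (Nat.dist j M : ℝ) ≤ m + 1 := by exact_mod_cast hdist
    linarith [mul_le_mul_of_nonneg_left hj' hσ, mul_le_mul_of_nonneg_left hdist' hs.le]
  set K := ENNReal.ofReal (2 ^ (s / 2) / (2 ^ (s / 2) - 1))
  calc (2 : ℝ≥0∞) ^ (σ * j) * (1 + m) ≤ 2 ^ (σ * j) * (K * 2 ^ (s / 2 * m)) := by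
        gcongr
        exact one_add_le_mul_two_rpow (half_pos hs) m
    _ = K * 2 ^ (σ * j + s / 2 * m) := by
        rw [two_rpow_add]
        ring
    _ ≤ K * 2 ^ (s + s / 4 + (-(s / 4) * m + -(s / 4) * Nat.dist j M) + (σ * M + s * m)) := by
        gcongr
        exact one_le_two
    _ = _ := by
        rw [two_rpow_add (s + s / 4 + _), two_rpow_add (s + s / 4), two_rpow_add (_ * _),
          two_rpow_add (σ * M), decayRatio_pow, decayRatio_pow, decayConst]
        ring

lemma two_pow_rpow (j : ℕ) (r : ℝ) : ((2 : ℝ≥0∞) ^ j) ^ r = 2 ^ (r * j) := by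
  rw [← ENNReal.rpow_natCast, ← ENNReal.rpow_mul, mul_comm]

lemma two_rpow_mul_two_rpow_le (hσs : σ ≤ s) (h : j₁ ≤ j₂) :
    (2 : ℝ≥0∞) ^ (σ * j₂) * 2 ^ (s * j₁) ≤ 2 ^ (σ * j₁) * 2 ^ (s * j₂) := by
  rw [← two_rpow_add, ← two_rpow_add]
  refine ENNReal.rpow_le_rpow_of_exponent_le one_le_two ?_
  have h' : (j₁ : ℝ) ≤ j₂ := by exact_mod_cast h
  linarith [mul_le_mul_of_nonneg_left h' (sub_nonneg.2 hσs)]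

lemma rpow_mul_interactionWeight_le (hs : 0 < s) (hσ : 0 ≤ σ) (hσs : σ ≤ s) (j j₁ j₂ : ℕ) :
    ((2 : ℝ≥0∞) ^ j) ^ σ * interactionWeight j j₁ j₂ ≤
      decayConst s * dyadicKernel (decayRatio s) j j₁ j₂ *
        (((2 : ℝ≥0∞) ^ j₁) ^ σ * ((2 : ℝ≥0∞) ^ j₂) ^ s) := by
  by_cases h : Interacts j j₁ j₂
  swap
  · simp [interactionWeight, h]
  obtain ⟨h₀, h₁, h₂⟩ := id h
  simp only [interactionWeight, if_pos h, two_pow_rpow, dyadicKernel]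
  rcases le_total j₁ j₂ with hle | hle
  · calc _ ≤ (2 : ℝ≥0∞) ^ (σ * j) * (1 + j₁) := by
          gcongr
          lia
      _ ≤ _ := two_rpow_mul_one_add_le hs hσ hσs (M := j₂) (by lia) (by lia)
      _ ≤ _ := by
          gcongr _ * ?_ * ?_
          · exact le_self_add
          · exact two_rpow_mul_two_rpow_le hσs hle
  · calc _ ≤ (2 : ℝ≥0∞) ^ (σ * j) * (1 + j₂) := by
          gcongr
          lia
      _ ≤ _ := two_rpow_mul_one_add_le hs hσ hσs (M := j₁) (by lia) (by lia)
      _ ≤ _ := by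
          gcongr
          exact le_add_self

end Decay

section Main

variable {s σ T : ℝ}

/-- The contribution of the frequency `N = 2 ^ j` to the norm `FBO s T u`. -/
def weightedBlockNorm (s T : ℝ) (u : ℝ → L2T) (j : ℕ) : ℝ≥0∞ :=
  ((2 : ℝ≥0∞) ^ j) ^ s * blockNorm T j u

lemma rpow_two_mul_mul_sq (x y : ℝ≥0∞) (r : ℝ) : x ^ (2 * r) * y ^ 2 = (x ^ r * y) ^ 2 := by
  rw [mul_pow, mul_comm 2 r, ENNReal.rpow_mul, ENNReal.rpow_ofNat]

lemma FBO_eq (s T : ℝ) (u : ℝ → L2T) :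
    FBO s T u = (∑' j, weightedBlockNorm s T u j ^ 2) ^ (1 / 2 : ℝ) := by
  simp_rw [weightedBlockNorm, ← rpow_two_mul_mul_sq]
  rfl

/-- The contribution of the frequency `N = 2 ^ j` to the norm `NBO s T g`. -/
def weightedDualBlockNorm (s T : ℝ) (g : ℝ → ℤ → ℂ) (j : ℕ) : ℝ≥0∞ :=
  ((2 : ℝ≥0∞) ^ j) ^ s * ⨆ (a : ℝ) (_ : 0 ≤ a) (_ : a + window T j ≤ T),
    DU2norm a (a + window T j) (fun t => flow (-t) (dyadicProj j (g t)))

lemma NBO_eq (s T : ℝ) (g : ℝ → ℤ → ℂ) :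
    NBO s T g = (∑' j, weightedDualBlockNorm s T g j ^ 2) ^ (1 / 2 : ℝ) := by
  simp_rw [weightedDualBlockNorm, ← rpow_two_mul_mul_sq]
  rfl

lemma weightedDualBlockNorm_dxMul_le (hs : 0 < s) (hσ : 0 ≤ σ) (hσs : σ ≤ s) (hT : 0 < T)
    (u v : ℝ → L2T) (j : ℕ) :
    weightedDualBlockNorm σ T (dxMul u v) j ≤
      16 * geomConst * decayConst s * ∑' p : ℕ × ℕ, dyadicKernel (decayRatio s) j p.1 p.2 *
        (weightedBlockNorm σ T u p.1 * weightedBlockNorm s T v p.2) := by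
  calc _ ≤ ((2 : ℝ≥0∞) ^ j) ^ σ * (16 * geomConst * ∑' p : ℕ × ℕ,
          interactionWeight j p.1 p.2 * (blockNorm T p.1 u * blockNorm T p.2 v)) := by
        rw [weightedDualBlockNorm]
        gcongr
        exact iSup_le fun a => iSup_le fun ha => iSup_le fun hb => DU2norm_dxMul_le hT ha hb
    _ = 16 * geomConst * ∑' p : ℕ × ℕ, ((2 : ℝ≥0∞) ^ j) ^ σ * interactionWeight j p.1 p.2 *
          (blockNorm T p.1 u * blockNorm T p.2 v) := by
        simp_rw [mul_assoc (((2 : ℝ≥0∞) ^ j) ^ σ)]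
        rw [ENNReal.tsum_mul_left]
        ring
    _ ≤ 16 * geomConst * ∑' p : ℕ × ℕ,
          decayConst s * dyadicKernel (decayRatio s) j p.1 p.2 *
            (((2 : ℝ≥0∞) ^ p.1) ^ σ * ((2 : ℝ≥0∞) ^ p.2) ^ s) *
            (blockNorm T p.1 u * blockNorm T p.2 v) := by
        gcongr _ * ∑' _, ?_ * _ with p
        exact rpow_mul_interactionWeight_le hs hσ hσs j p.1 p.2
    _ = _ := by
        rw [mul_assoc (16 * geomConst), ← ENNReal.tsum_mul_left (a := decayConst s)]
        congr 1
        refine tsum_congr fun p => ?_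
        simp only [weightedBlockNorm]
        ring

/-- The constant in the bilinear estimate. -/
def bilinearConst (s : ℝ) : ℝ≥0∞ :=
  (16 * geomConst * decayConst s) ^ 2 * (16 * (1 - decayRatio s)⁻¹ ^ 3)

lemma bilinearConst_ne_top (hs : 0 < s) : bilinearConst s ≠ ∞ := by
  have hratio : (1 - decayRatio s)⁻¹ ≠ ∞ :=
    ENNReal.inv_ne_top.2 (tsub_pos_of_lt (decayRatio_lt_one hs)).ne'
  have := geomConst_ne_top
  have := decayConst_ne_top s
  unfold bilinearConst
  finiteness

lemma NBO_dxMul_le (hs : 0 < s) (hσ : 0 ≤ σ) (hσs : σ ≤ s) (hT : 0 < T) (u v : ℝ → L2T) :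
    NBO σ T (dxMul u v) ≤ bilinearConst s ^ (1 / 2 : ℝ) * FBO σ T u * FBO s T v := by
  rw [NBO_eq, FBO_eq, FBO_eq, mul_assoc, ← ENNReal.mul_rpow_of_nonneg _ _ (by norm_num),
    ← ENNReal.mul_rpow_of_nonneg _ _ (by norm_num)]
  gcongr
  calc _ ≤ ∑' j, (16 * geomConst * decayConst s *
        ∑' p : ℕ × ℕ, dyadicKernel (decayRatio s) j p.1 p.2 *
          (weightedBlockNorm σ T u p.1 * weightedBlockNorm s T v p.2)) ^ 2 := by
        gcongr with j
        exact weightedDualBlockNorm_dxMul_le hs hσ hσs hT u v j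
    _ ≤ (16 * geomConst * decayConst s) ^ 2 * (16 * (∑' n, decayRatio s ^ n) ^ 3 *
          ((∑' j, weightedBlockNorm σ T u j ^ 2) * ∑' j, weightedBlockNorm s T v j ^ 2)) := by
        simp_rw [mul_pow (16 * geomConst * decayConst s), ENNReal.tsum_mul_left]
        gcongr
        exact tsum_sq_tsum_dyadicKernel_mul_le (decayRatio_lt_one hs).le _ _
    _ = _ := by
        rw [ENNReal.tsum_geometric, bilinearConst]
        ring

end Main

end

end ShortTimeBO

open ShortTimeBO in
theorem mainTheorem5_general (s : ℝ) (hs : 0 < s) :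
    ∃ C : ℝ≥0, ∀ σ : ℝ, 0 ≤ σ → σ ≤ s → ∀ T : ℝ, 0 < T → ∀ u v : ℝ → L2T,
      NBO σ T (dxMul u v) ≤ C * FBO σ T u * FBO s T v := by
  refine ⟨(bilinearConst s ^ (1 / 2 : ℝ)).toNNReal, fun σ hσ hσs T hT u v => ?_⟩
  rw [ENNReal.coe_toNNReal
    (ENNReal.rpow_ne_top_of_nonneg (by norm_num) (bilinearConst_ne_top hs))]
  exact NBO_dxMul_le hs hσ hσs hT u v

open ShortTimeBO in
theorem mainTheorem5 (s : ℝ) (hs : 0 < s) :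
    ∃ C : ℝ≥0, ∀ T : ℝ, 0 < T → T ≤ 1 → ∀ u v : ℝ → L2T,
      NBO s T (dxMul u v) ≤ C * FBO s T u * FBO s T v ∧
      NBO 0 T (dxMul u v) ≤ C * FBO 0 T u * FBO s T v := by
  obtain ⟨C, hC⟩ := mainTheorem5_general s hs
  exact ⟨C, fun T hT _ u v => ⟨hC s hs.le le_rfl T hT u v, hC 0 le_rfl hs.le T hT u v⟩⟩
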